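/- All graphs are finite and simple. A partially labeled graph is a graph some of whose vertices carry distinct natural numbers as labels; let $\mathcal F$ be the commutative monoid of partially labeled graphs up to label-preserving isomorphism, where $H_1\cdot H_2$ is the disjoint union with equally labeled vertices identified and multiple edges reduced to one copy; its unit is the graph $\emptyset$ without vertices. Let $\mathcal K$ be the ideal of $\mathbb R[\mathcal F]$ generated by all $F-\emptyset$ with $F$ a (labeled or unlabeled) one-vertex graph, let $\mathcal A=\mathbb R[\mathcal F]/\mathcal K$, and let $\mathcal A_\emptyset\subseteq\mathcal A$ (the quantum graphs) be the image of the linear span of the graphs without labels. Let $[\![\cdot]\!]:\mathcal A\to\mathcal A$ be the linear map induced by removing all labels. For a graph $G$ with at least one vertex and a map $\phi$ from labels to $V(G)$, let $t(H;G,\phi)$ be the probability that a uniformly random map $V(H)\to V(G)$ is a homomorphism, conditioned on labeled vertices being mapped according to $\phi$; this extends linearly to $\mathcal A$. A quantum graph $x\in\mathcal A_\emptyset$ is positive if $t(x;G)\ge 0$ for every graph $G$ with at least one vertex, and is expressible as a sum of squares if $x=[\![\sum_{i=1}^m g_i^2]\!]$ for some $m$ and $g_1,\dots,g_m\in\mathcal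 A$. For a partially labeled graph $H$ put $\operatorname{ind}(H)=\sum_{F\supseteq H,\,V(F)=V(H)}(-1)^{|E(F)\setminus E(H)|}F$. For a graph $H$ with vertex set $[k]=\{1,\dots,k\}$ and $j\in[k]$, let $H_j$ be $H$ with every vertex labeled by itself, together with one new unlabeled vertex adjacent exactly to the neighbors of $j$, and let $H_j'$ be $H_j$ with an additional edge between $j$ and the new vertex; let $\varphi_H:\mathbb R[x_1,\dots,x_k]\to\mathcal A$ be the algebra homomorphism with $\varphi_H(x_j)=\operatorname{ind}(H_j)+\operatorname{ind}(H_j')$. Call $H$ stringent if its only automorphism is the identity and there is no set $W\subseteq V(H)$ with $1<|W|\le|V(H)|-1$ such that $N(u)\setminus W=N(v)\setminus W$ for all $u,v\in W$, where $N(u)$ denotes the set of neighbors of $u$. Call a homogeneous polynomial $p\in\mathbb R[x_1,\dots,x_k]$ admissible if the even polynomial $P=x_1^2\cdots x_k^2\,p(x_1^2,\dots,x_k^2)$ is nonnegative on $\mathbb R^k$, is not a sum of squares of polynomials, and has $(1,0,\dots,0)$ as a bad point, i.e. every polynomial $q$ such that $q^2P$ is a homogeneous sum of squares of polynomials satisfies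 $q(1,0,\dots,0)=0$. **Theorem.** There exists a positive quantum graph $x\in\mathcal A_\emptyset$ that cannot be expressed as a sum of squares. Explicitly, there are an integer $k\ge4$, a stringent graph $H$ with vertex set $[k]$ and an admissible $p\in\mathbb R[x_1,\dots,x_k]$ such that $x=[\![\varphi_H(p)]\!]$ has these properties; and for all $k\ge4$, all stringent $H$ with vertex set $[k]$ and all admissible $p\in\mathbb R[x_1,\dots,x_k]$, the element $[\![\varphi_H(p)]\!]$ is a positive quantum graph that cannot be expressed as a sum of squares. -/

import Mathlib

noncomputable section

namespace QuantumGraph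

/-- A partially labeled finite simple graph: `labels` is the set of labels that occur, and `U` is
the finite set of unlabeled vertices. The labeled vertices are identified with their labels, so
that the vertex set is the disjoint union of `labels` and `U`. -/
structure PLGraph : Type 1 where
  labels : Finset ℕ
  U : Type
  [fintypeU : Fintype U]
  graph : SimpleGraph (labels ⊕ U)

attribute [instance] PLGraph.fintypeU

namespace PLGraph

/-- The vertex set. -/
abbrev Vert (H : PLGraph) : Type := H.labels ⊕ H.U

/-- Label-preserving isomorphism: both graphs have the same labels, and some bijection of the
unlabeled vertices, together with the identity on labels, is a graph isomorphism. -/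
def Iso (H H' : PLGraph) : Prop :=
  ∃ (hL : H.labels = H'.labels) (e : H.U ≃ H'.U), ∀ u v : H.Vert,
    H.graph.Adj u v ↔
      H'.graph.Adj (Sum.map (fun a => ⟨a.1, hL ▸ a.2⟩) e u) (Sum.map (fun a => ⟨a.1, hL ▸ a.2⟩) e v)

theorem Iso.refl (H : PLGraph) : H.Iso H :=
  ⟨rfl, Equiv.refl _, fun u v => by rcases u with u | u <;> rcases v with v | v <;> rfl⟩

theorem Iso.symm {H H' : PLGraph} (h : H.Iso H') : H'.Iso H := by
  obtain ⟨L, U, Γ⟩ := H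
  obtain ⟨L', U', Γ'⟩ := H'
  obtain ⟨hL, e, he⟩ := h
  dsimp only at hL
  subst hL
  refine ⟨rfl, e.symm, fun u v => ?_⟩
  dsimp only at he ⊢
  rw [he]
  rcases u with u | u <;> rcases v with v | v <;> simp

theorem Iso.trans {H H' H'' : PLGraph} (h : H.Iso H') (h' : H'.Iso H'') : H.Iso H'' := by
  obtain ⟨L, U, Γ⟩ := H
  obtain ⟨L', U', Γ'⟩ := H'
  obtain ⟨L'', U'', Γ''⟩ := H''
  obtain ⟨hL, e, he⟩ := h
  obtain ⟨hL', e', he'⟩ := h'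
  dsimp only at hL hL'
  subst hL hL'
  refine ⟨rfl, e.trans e', fun u v => ?_⟩
  dsimp only at he he' ⊢
  rw [he, he']
  rcases u with u | u <;> rcases v with v | v <;> simp

instance setoid : Setoid PLGraph := ⟨Iso, Iso.refl, Iso.symm, Iso.trans⟩

/-- The graph `∅` without vertices. -/
abbrev empty : PLGraph := ⟨∅, Empty, ⊥⟩

/-- The graph with one vertex, labeled `a`. -/
abbrev labeledPoint (a : ℕ) : PLGraph := ⟨{a}, Empty, ⊥⟩

/-- The graph with one vertex, without a label. -/
abbrev unlabeledPoint : PLGraph := ⟨∅, Unit, ⊥⟩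

/-- The vertices of the first factor, inside the glued vertex set. -/
def glueLeft (L₁ L₂ : Finset ℕ) (U₁ U₂ : Type) : (L₁ ⊕ U₁) ↪ ((L₁ ∪ L₂ : Finset ℕ) ⊕ (U₁ ⊕ U₂)) where
  toFun := Sum.map (fun a => ⟨a.1, Finset.mem_union_left _ a.2⟩) Sum.inl
  inj' := Sum.map_injective.2
    ⟨fun _ _ h => Subtype.ext (congrArg (fun c => c.1) h), Sum.inl_injective⟩

/-- The vertices of the second factor, inside the glued vertex set. -/
def glueRight (L₁ L₂ : Finset ℕ) (U₁ U₂ : Type) : (L₂ ⊕ U₂) ↪ ((L₁ ∪ L₂ : Finset ℕ) ⊕ (U₁ ⊕ U₂)) where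
  toFun := Sum.map (fun a => ⟨a.1, Finset.mem_union_right _ a.2⟩) Sum.inr
  inj' := Sum.map_injective.2
    ⟨fun _ _ h => Subtype.ext (congrArg (fun c => c.1) h), Sum.inr_injective⟩

/-- The product: disjoint union, vertices with the same label identified, and only one copy of
each edge kept. -/
abbrev mul (H₁ H₂ : PLGraph) : PLGraph where
  labels := H₁.labels ∪ H₂.labels
  U := H₁.U ⊕ H₂.U
  graph := H₁.graph.map (glueLeft H₁.labels H₂.labels H₁.U H₂.U) ⊔
    H₂.graph.map (glueRight H₁.labels H₂.labels H₁.U H₂.U)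

theorem mul_graph_adj (H₁ H₂ : PLGraph) (u v : (mul H₁ H₂).Vert) :
    (mul H₁ H₂).graph.Adj u v ↔
      (∃ a b, H₁.graph.Adj a b ∧ glueLeft H₁.labels H₂.labels H₁.U H₂.U a = u ∧
        glueLeft H₁.labels H₂.labels H₁.U H₂.U b = v) ∨
      (∃ a b, H₂.graph.Adj a b ∧ glueRight H₁.labels H₂.labels H₁.U H₂.U a = u ∧
        glueRight H₁.labels H₂.labels H₁.U H₂.U b = v) :=
  or_congr (SimpleGraph.map_adj _ _ _ _) (SimpleGraph.map_adj _ _ _ _)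

/-- Removing all labels, with the vertices and the edges kept. -/
abbrev unlabel (H : PLGraph) : PLGraph where
  labels := ∅
  U := H.labels ⊕ H.U
  graph := H.graph.map Function.Embedding.inr

/-- `h` maps the unlabeled vertices of `H` to `G`; together with the images `φ` of the labeled
vertices it is a homomorphism from `H` to `G`. -/
def IsHom {V : Type} (H : PLGraph) (G : SimpleGraph V) (φ : ℕ → V) (h : H.U → V) : Prop :=
  ∀ u v : H.Vert, H.graph.Adj u v →
    G.Adj (Sum.elim (fun a : H.labels => φ a.1) h u) (Sum.elim (fun a : H.labels => φ a.1) h v)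

/-- `t(H; G, φ)`: the probability that a uniformly random map from the vertices of `H` to the
vertices of `G` is a homomorphism, given that labeled vertices are mapped according to `φ`.
Only the values of `φ` on the labels of `H` matter. -/
def density {V : Type} [Fintype V] (H : PLGraph) (G : SimpleGraph V) (φ : ℕ → V) : ℝ :=
  (Nat.card {h : H.U → V // H.IsHom G φ h} : ℝ) / (Fintype.card V : ℝ) ^ Fintype.card H.U

/-! Compatibility of these operations with isomorphism. -/

/-- The vertices of `H` as elements of `ℕ ⊕ U`. -/
def vertEmb (H : PLGraph) : H.Vert ↪ ℕ ⊕ H.U where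
  toFun := Sum.map Subtype.val id
  inj' := Sum.map_injective.2 ⟨Subtype.val_injective, fun _ _ h => h⟩

/-- The graph `H` on the larger vertex set `ℕ ⊕ U`. -/
def ext (H : PLGraph) : SimpleGraph (ℕ ⊕ H.U) :=
  H.graph.map (vertEmb H)

theorem ext_adj (H : PLGraph) (x y : ℕ ⊕ H.U) :
    H.ext.Adj x y ↔ ∃ u v : H.Vert, H.graph.Adj u v ∧
      Sum.map Subtype.val id u = x ∧ Sum.map Subtype.val id v = y :=
  SimpleGraph.map_adj (vertEmb H) H.graph x y

theorem ext_adj_val (H : PLGraph) (u v : H.Vert) :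
    H.ext.Adj (Sum.map Subtype.val id u) (Sum.map Subtype.val id v) ↔ H.graph.Adj u v :=
  SimpleGraph.map_adj_apply (f := vertEmb H)

theorem iso_of_ext {H H' : PLGraph} (hL : H.labels = H'.labels) (e : H.U ≃ H'.U)
    (h : ∀ x y, H.ext.Adj x y ↔ H'.ext.Adj (Sum.map id e x) (Sum.map id e y)) : H.Iso H' := by
  refine ⟨hL, e, fun u v => ?_⟩
  rw [← H.ext_adj_val, ← H'.ext_adj_val, h]
  rcases u with u | u <;> rcases v with v | v <;> rfl

theorem mul_ext_adj (H₁ H₂ : PLGraph) (x y : ℕ ⊕ (H₁.U ⊕ H₂.U)) :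
    (mul H₁ H₂).ext.Adj x y ↔
      (∃ u v, H₁.ext.Adj u v ∧ Sum.map id Sum.inl u = x ∧ Sum.map id Sum.inl v = y) ∨
      (∃ u v, H₂.ext.Adj u v ∧ Sum.map id Sum.inr u = x ∧ Sum.map id Sum.inr v = y) := by
  rw [ext_adj]
  constructor
  · rintro ⟨u, v, h, rfl, rfl⟩
    have h := (mul_graph_adj H₁ H₂ u v).1 h
    rcases h with ⟨a, b, hh, rfl, rfl⟩ | ⟨a, b, hh, rfl, rfl⟩
    · refine Or.inl ⟨_, _, (H₁.ext_adj_val a b).2 hh, ?_, ?_⟩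
      · rcases a with a | a <;> rfl
      · rcases b with b | b <;> rfl
    · refine Or.inr ⟨_, _, (H₂.ext_adj_val a b).2 hh, ?_, ?_⟩
      · rcases a with a | a <;> rfl
      · rcases b with b | b <;> rfl
  · rintro (⟨u, v, h, rfl, rfl⟩ | ⟨u, v, h, rfl, rfl⟩)
    · obtain ⟨a, b, hh, rfl, rfl⟩ := (H₁.ext_adj _ _).1 h
      refine ⟨glueLeft _ _ _ _ a, glueLeft _ _ _ _ b, Or.inl ?_, ?_, ?_⟩
      · exact SimpleGraph.map_adj_apply.2 hh
      · rcases a with a | a <;> rfl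
      · rcases b with b | b <;> rfl
    · obtain ⟨a, b, hh, rfl, rfl⟩ := (H₂.ext_adj _ _).1 h
      refine ⟨glueRight _ _ _ _ a, glueRight _ _ _ _ b, Or.inr ?_, ?_, ?_⟩
      · exact SimpleGraph.map_adj_apply.2 hh
      · rcases a with a | a <;> rfl
      · rcases b with b | b <;> rfl

theorem iso_iff_ext {H H' : PLGraph} : H.Iso H' ↔ H.labels = H'.labels ∧ ∃ e : H.U ≃ H'.U,
    ∀ x y, H.ext.Adj x y ↔ H'.ext.Adj (Sum.map id e x) (Sum.map id e y) := by
  constructor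
  · intro h
    obtain ⟨L, U, Γ⟩ := H
    obtain ⟨L', U', Γ'⟩ := H'
    obtain ⟨hL, e, he⟩ := h
    dsimp only at hL
    subst hL
    refine ⟨rfl, e, fun x y => ?_⟩
    dsimp only at he e x y
    rw [ext_adj, ext_adj]
    constructor
    · rintro ⟨u, v, h, rfl, rfl⟩
      refine ⟨_, _, (he u v).1 h, ?_, ?_⟩
      · rcases u with u | u <;> rfl
      · rcases v with v | v <;> rfl
    · rintro ⟨u, v, h, hu, hv⟩
      refine ⟨Sum.map id e.symm u, Sum.map id e.symm v, (he _ _).2 ?_, ?_, ?_⟩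
      · rcases u with u | u <;> rcases v with v | v <;> simpa using h
      · rcases u with u | u <;> rcases x with x | x <;> simp_all
      · rcases v with v | v <;> rcases y with y | y <;> simp_all
  · rintro ⟨hL, e, h⟩
    exact iso_of_ext hL e h

theorem mul_congr {H₁ H₁' H₂ H₂' : PLGraph} (h₁ : H₁.Iso H₁') (h₂ : H₂.Iso H₂') :
    (mul H₁ H₂).Iso (mul H₁' H₂') := by
  obtain ⟨hL₁, e₁, h₁⟩ := iso_iff_ext.1 h₁
  obtain ⟨hL₂, e₂, h₂⟩ := iso_iff_ext.1 h₂
  refine iso_of_ext (congrArg₂ (· ∪ ·) hL₁ hL₂) (Equiv.sumCongr e₁ e₂) fun x y => ?_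
  rw [mul_ext_adj]
  refine Iff.trans ?_ (mul_ext_adj H₁' H₂' _ _).symm
  refine or_congr ⟨?_, ?_⟩ ⟨?_, ?_⟩
  · rintro ⟨u, v, h, rfl, rfl⟩
    refine ⟨_, _, (h₁ u v).1 h, ?_, ?_⟩
    · rcases u with u | u <;> rfl
    · rcases v with v | v <;> rfl
  · rintro ⟨u, v, h, hu, hv⟩
    refine ⟨Sum.map id e₁.symm u, Sum.map id e₁.symm v, (h₁ _ _).2 ?_, ?_, ?_⟩
    · rcases u with u | u <;> rcases v with v | v <;> simpa using h
    · rcases u with u | u <;> rcases x with x | x | x <;> simp_all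
    · rcases v with v | v <;> rcases y with y | y | y <;> simp_all
  · rintro ⟨u, v, h, rfl, rfl⟩
    refine ⟨_, _, (h₂ u v).1 h, ?_, ?_⟩
    · rcases u with u | u <;> rfl
    · rcases v with v | v <;> rfl
  · rintro ⟨u, v, h, hu, hv⟩
    refine ⟨Sum.map id e₂.symm u, Sum.map id e₂.symm v, (h₂ _ _).2 ?_, ?_, ?_⟩
    · rcases u with u | u <;> rcases v with v | v <;> simpa using h
    · rcases u with u | u <;> rcases x with x | x | x <;> simp_all
    · rcases v with v | v <;> rcases y with y | y | y <;> simp_all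

theorem mul_comm_iso (H₁ H₂ : PLGraph) : (mul H₁ H₂).Iso (mul H₂ H₁) := by
  refine iso_of_ext (Finset.union_comm _ _) (Equiv.sumComm _ _) fun x y => ?_
  rw [mul_ext_adj]
  refine Iff.trans ?_ (mul_ext_adj H₂ H₁ _ _).symm
  rw [or_comm]
  refine or_congr ⟨?_, ?_⟩ ⟨?_, ?_⟩
  all_goals
    rintro ⟨u, v, h, hu, hv⟩
    refine ⟨u, v, h, ?_, ?_⟩
    · rcases u with u | u <;> rcases x with x | x | x <;> simp_all
    · rcases v with v | v <;> rcases y with y | y | y <;> simp_all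

theorem mul_assoc_iso (H₁ H₂ H₃ : PLGraph) :
    (mul (mul H₁ H₂) H₃).Iso (mul H₁ (mul H₂ H₃)) := by
  refine iso_of_ext (Finset.union_assoc _ _ _) (Equiv.sumAssoc _ _ _) fun x y => ?_
  rw [mul_ext_adj]
  refine Iff.trans ?_ (mul_ext_adj H₁ (mul H₂ H₃) _ _).symm
  constructor
  · rintro (⟨u, v, h, rfl, rfl⟩ | ⟨u, v, h, rfl, rfl⟩)
    · rcases (mul_ext_adj H₁ H₂ u v).1 h with ⟨a, b, hh, rfl, rfl⟩ | ⟨a, b, hh, rfl, rfl⟩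
      · refine Or.inl ⟨a, b, hh, ?_, ?_⟩
        · rcases a with a | a <;> rfl
        · rcases b with b | b <;> rfl
      · refine Or.inr ⟨_, _, (mul_ext_adj H₂ H₃ _ _).2 (Or.inl ⟨a, b, hh, rfl, rfl⟩), ?_, ?_⟩
        · rcases a with a | a <;> rfl
        · rcases b with b | b <;> rfl
    · refine Or.inr ⟨_, _, (mul_ext_adj H₂ H₃ _ _).2 (Or.inr ⟨u, v, h, rfl, rfl⟩), ?_, ?_⟩
      · rcases u with a | a <;> rfl
      · rcases v with b | b <;> rfl
  · rintro (⟨u, v, h, hu, hv⟩ | ⟨u, v, h, hu, hv⟩)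
    · refine Or.inl ⟨_, _, (mul_ext_adj H₁ H₂ _ _).2 (Or.inl ⟨u, v, h, rfl, rfl⟩), ?_, ?_⟩
      · apply (Sum.map_injective.2 ⟨Function.injective_id, (Equiv.sumAssoc _ _ _).injective⟩)
        rw [← hu]
        rcases u with a | a <;> rfl
      · apply (Sum.map_injective.2 ⟨Function.injective_id, (Equiv.sumAssoc _ _ _).injective⟩)
        rw [← hv]
        rcases v with a | a <;> rfl
    · rcases (mul_ext_adj H₂ H₃ u v).1 h with ⟨a, b, hh, rfl, rfl⟩ | ⟨a, b, hh, rfl, rfl⟩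
      · refine Or.inl ⟨_, _, (mul_ext_adj H₁ H₂ _ _).2 (Or.inr ⟨a, b, hh, rfl, rfl⟩), ?_, ?_⟩
        · apply (Sum.map_injective.2 ⟨Function.injective_id, (Equiv.sumAssoc _ _ _).injective⟩)
          rw [← hu]
          rcases a with a | a <;> rfl
        · apply (Sum.map_injective.2 ⟨Function.injective_id, (Equiv.sumAssoc _ _ _).injective⟩)
          rw [← hv]
          rcases b with a | a <;> rfl
      · refine Or.inr ⟨a, b, hh, ?_, ?_⟩
        · apply (Sum.map_injective.2 ⟨Function.injective_id, (Equiv.sumAssoc _ _ _).injective⟩)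
          rw [← hu]
          rcases a with a | a <;> rfl
        · apply (Sum.map_injective.2 ⟨Function.injective_id, (Equiv.sumAssoc _ _ _).injective⟩)
          rw [← hv]
          rcases b with a | a <;> rfl

theorem not_ext_adj_of_bot {H : PLGraph} (hH : H.graph = ⊥) (x y : ℕ ⊕ H.U) :
    ¬ H.ext.Adj x y := by
  rw [ext_adj]
  rintro ⟨u, v, h, -⟩
  rw [hH] at h
  exact h

/-- Multiplying by an edgeless graph all of whose vertices are labels of `H` changes nothing. -/
theorem mul_iso_self (H P : PLGraph) (hP : P.graph = ⊥) [IsEmpty P.U] (hL : P.labels ⊆ H.labels) :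
    (mul H P).Iso H := by
  refine iso_of_ext (Finset.union_eq_left.2 hL) (Equiv.sumEmpty _ _) fun x y => ?_
  rw [mul_ext_adj]
  constructor
  · rintro (⟨u, v, h, rfl, rfl⟩ | ⟨u, v, h, -⟩)
    · rcases u with u | u <;> rcases v with v | v <;> exact h
    · exact absurd h (not_ext_adj_of_bot hP _ _)
  · intro h
    refine Or.inl ⟨_, _, h, ?_, ?_⟩
    · rcases x with x | x | x
      · rfl
      · rfl
      · exact isEmptyElim x
    · rcases y with x | x | x
      · rfl
      · rfl
      · exact isEmptyElim x

theorem unlabel_ext_adj (H : PLGraph) (x y : ℕ ⊕ (H.labels ⊕ H.U)) :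
    H.unlabel.ext.Adj x y ↔ ∃ u v, H.graph.Adj u v ∧ Sum.inr u = x ∧ Sum.inr v = y := by
  rw [ext_adj]
  simp only [unlabel, SimpleGraph.map_adj]
  constructor
  · rintro ⟨_, _, ⟨u, v, h, rfl, rfl⟩, rfl, rfl⟩
    exact ⟨u, v, h, rfl, rfl⟩
  · rintro ⟨u, v, h, rfl, rfl⟩
    exact ⟨_, _, ⟨u, v, h, rfl, rfl⟩, rfl, rfl⟩

theorem unlabel_congr {H H' : PLGraph} (h : H.Iso H') : H.unlabel.Iso H'.unlabel := by
  obtain ⟨L, U, Γ⟩ := H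
  obtain ⟨L', U', Γ'⟩ := H'
  obtain ⟨hL, e, he⟩ := h
  dsimp only at hL
  subst hL
  refine iso_of_ext rfl (Equiv.sumCongr (Equiv.refl _) e) fun x y => ?_
  rw [unlabel_ext_adj]
  refine Iff.trans ?_ (unlabel_ext_adj _ _ _).symm
  dsimp only at he e x y ⊢
  constructor
  · rintro ⟨u, v, h, rfl, rfl⟩
    exact ⟨_, _, (he u v).1 h, rfl, rfl⟩
  · rintro ⟨u, v, h, hu, hv⟩
    refine ⟨Sum.map id e.symm u, Sum.map id e.symm v, (he _ _).2 ?_, ?_, ?_⟩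
    · rcases u with u | u <;> rcases v with v | v <;> simpa using h
    · rcases u with u | u <;> rcases x with x | x | x <;> simp_all
    · rcases v with v | v <;> rcases y with y | y | y <;> simp_all

/-- Unlabeling `H · P` for an edgeless `P` gives the unlabeled `H` and isolated vertices; here for
a `P` with exactly one vertex that is not a label of `H`. -/
theorem unlabel_mul_point (H P : PLGraph) (hP : P.graph = ⊥)
    (e : ((H.labels ∪ P.labels : Finset ℕ) ⊕ (H.U ⊕ P.U)) ≃ ((H.labels ⊕ H.U) ⊕ Unit))
    (he : ∀ u, e (glueLeft H.labels P.labels H.U P.U u) = Sum.inl u) :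
    (mul H P).unlabel.Iso (mul H.unlabel unlabeledPoint) := by
  refine iso_of_ext rfl e fun x y => ?_
  rw [unlabel_ext_adj]
  refine Iff.trans ?_ (mul_ext_adj _ _ _ _).symm
  constructor
  · rintro ⟨u, v, h, rfl, rfl⟩
    have h := (mul_graph_adj H P u v).1 h
    rw [hP] at h
    rcases h with ⟨a, b, hh, rfl, rfl⟩ | ⟨a, b, hh, -⟩
    · refine Or.inl ⟨_, _, (unlabel_ext_adj _ _ _).2 ⟨a, b, hh, rfl, rfl⟩, ?_, ?_⟩
      · exact (congrArg Sum.inr (he a)).symm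
      · exact (congrArg Sum.inr (he b)).symm
    · exact hh.elim
  · rintro (⟨u, v, h, hu, hv⟩ | ⟨u, v, h, -⟩)
    · obtain ⟨a, b, hh, rfl, rfl⟩ := (unlabel_ext_adj _ _ _).1 h
      refine ⟨glueLeft _ _ _ _ a, glueLeft _ _ _ _ b, Or.inl (SimpleGraph.map_adj_apply.2 hh), ?_, ?_⟩
      · apply (Sum.map_injective.2 ⟨Function.injective_id, e.injective⟩)
        rw [← hu]
        exact congrArg Sum.inr (he a)
      · apply (Sum.map_injective.2 ⟨Function.injective_id, e.injective⟩)
        rw [← hv]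
        exact congrArg Sum.inr (he b)
    · exact absurd h (not_ext_adj_of_bot rfl _ _)

theorem exists_unlabel_equiv (H P : PLGraph)
    (hc : ∃ w : ((H.labels ∪ P.labels : Finset ℕ) ⊕ (H.U ⊕ P.U)),
      (∀ u, glueLeft H.labels P.labels H.U P.U u ≠ w) ∧
      ∀ z, (∃ u, glueLeft H.labels P.labels H.U P.U u = z) ∨ z = w) :
    ∃ e : ((H.labels ∪ P.labels : Finset ℕ) ⊕ (H.U ⊕ P.U)) ≃ ((H.labels ⊕ H.U) ⊕ Unit),
      ∀ u, e (glueLeft H.labels P.labels H.U P.U u) = Sum.inl u := by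
  obtain ⟨w, hw, hz⟩ := hc
  let f : ((H.labels ⊕ H.U) ⊕ Unit) → ((H.labels ∪ P.labels : Finset ℕ) ⊕ (H.U ⊕ P.U)) :=
    Sum.elim (glueLeft H.labels P.labels H.U P.U) (fun _ => w)
  have hf : Function.Bijective f := by
    refine ⟨?_, fun z => ?_⟩
    · exact Function.Injective.sumElim (glueLeft H.labels P.labels H.U P.U).injective
        (fun _ _ _ => rfl) (fun u _ => hw u)
    · rcases hz z with ⟨u, rfl⟩ | rfl
      · exact ⟨Sum.inl u, rfl⟩
      · exact ⟨Sum.inr (), rfl⟩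
  refine ⟨(Equiv.ofBijective f hf).symm, fun u => ?_⟩
  rw [Equiv.symm_apply_eq]
  rfl

theorem unlabel_mul_unlabeledPoint (H : PLGraph) :
    (mul H unlabeledPoint).unlabel.Iso (mul H.unlabel unlabeledPoint) := by
  obtain ⟨e, he⟩ := exists_unlabel_equiv H unlabeledPoint
    ⟨Sum.inr (Sum.inr ()), by rintro (u | u) <;> simp [glueLeft], by
      rintro (⟨z, hz⟩ | z | z)
      · exact Or.inl ⟨Sum.inl ⟨z, by simpa [unlabeledPoint] using hz⟩, rfl⟩
      · exact Or.inl ⟨Sum.inr z, rfl⟩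
      · exact Or.inr rfl⟩
  exact unlabel_mul_point H _ rfl e he

theorem unlabel_mul_labeledPoint (H : PLGraph) (a : ℕ) (ha : a ∉ H.labels) :
    (mul H (labeledPoint a)).unlabel.Iso (mul H.unlabel unlabeledPoint) := by
  obtain ⟨e, he⟩ := exists_unlabel_equiv H (labeledPoint a)
    ⟨Sum.inl ⟨a, by simp⟩, by
      rintro (⟨u, hu⟩ | u)
      · intro h
        simp only [glueLeft, Function.Embedding.coeFn_mk, Sum.map_inl, Sum.inl.injEq,
          Subtype.mk.injEq] at h
        exact ha (h ▸ hu)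
      · simp [glueLeft], by
      rintro (⟨z, hz⟩ | z | z)
      · rcases Finset.mem_union.1 hz with h | h
        · exact Or.inl ⟨Sum.inl ⟨z, h⟩, rfl⟩
        · refine Or.inr ?_
          have : z = a := by simpa [labeledPoint] using h
          subst this
          rfl
      · exact Or.inl ⟨Sum.inr z, rfl⟩
      · exact z.elim⟩
  exact unlabel_mul_point H _ rfl e he

section density

variable {V : Type} [Fintype V] (G : SimpleGraph V) (φ : ℕ → V)

theorem density_congr {H H' : PLGraph} (h : H.Iso H') : H.density G φ = H'.density G φ := by
  obtain ⟨L, U, Γ⟩ := H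
  obtain ⟨L', U', Γ'⟩ := H'
  obtain ⟨hL, e, he⟩ := h
  dsimp only at hL
  subst hL
  dsimp only at he e
  have hcard : Fintype.card U = Fintype.card U' := Fintype.card_congr e
  have hc : Nat.card {h : U → V // IsHom ⟨L, U, Γ⟩ G φ h} =
      Nat.card {h : U' → V // IsHom ⟨L, U', Γ'⟩ G φ h} := by
    refine Nat.card_congr (Equiv.subtypeEquiv (Equiv.arrowCongr e (Equiv.refl V)) fun h => ?_)
    constructor
    · intro hh u v huv
      have := hh (Sum.map id e.symm u) (Sum.map id e.symm v) ((he _ _).2 (by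
        rcases u with u | u <;> rcases v with v | v <;> simpa using huv))
      rcases u with u | u <;> rcases v with v | v <;> simpa using this
    · intro hh u v huv
      have := hh _ _ ((he u v).1 huv)
      rcases u with u | u <;> rcases v with v | v <;> simpa using this
  simp only [density, hcard, hc]

theorem density_mul (H₁ H₂ : PLGraph) :
    (mul H₁ H₂).density G φ = H₁.density G φ * H₂.density G φ := by
  have hc : Nat.card {h : (mul H₁ H₂).U → V // (mul H₁ H₂).IsHom G φ h} =
      Nat.card {h : H₁.U → V // H₁.IsHom G φ h} * Nat.card {h : H₂.U → V // H₂.IsHom G φ h} := by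
    rw [← Nat.card_prod]
    refine Nat.card_congr ((Equiv.subtypeEquiv (Equiv.sumArrowEquivProdArrow _ _ _)
      (q := fun c => H₁.IsHom G φ c.1 ∧ H₂.IsHom G φ c.2) fun h => ?_).trans
      (Equiv.subtypeProdEquivProd (p := fun c => H₁.IsHom G φ c) (q := fun c => H₂.IsHom G φ c)))
    constructor
    · intro hh
      constructor
      · intro u v huv
        have := hh (glueLeft _ _ _ _ u) (glueLeft _ _ _ _ v)
          (Or.inl (SimpleGraph.map_adj_apply.2 huv))
        rcases u with u | u <;> rcases v with v | v <;> exact this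
      · intro u v huv
        have := hh (glueRight _ _ _ _ u) (glueRight _ _ _ _ v)
          (Or.inr (SimpleGraph.map_adj_apply.2 huv))
        rcases u with u | u <;> rcases v with v | v <;> exact this
    · rintro ⟨h1, h2⟩ u v huv
      have huv := (mul_graph_adj H₁ H₂ u v).1 huv
      rcases huv with ⟨a, b, hab, rfl, rfl⟩ | ⟨a, b, hab, rfl, rfl⟩
      · have := h1 a b hab
        rcases a with a | a <;> rcases b with b | b <;> exact this
      · have := h2 a b hab
        rcases a with a | a <;> rcases b with b | b <;> exact this
  have hU : Fintype.card (mul H₁ H₂).U = Fintype.card H₁.U + Fintype.card H₂.U :=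
    Fintype.card_sum
  simp only [density, hc, hU, pow_add, Nat.cast_mul]
  rw [mul_div_mul_comm]

theorem density_of_bot [Nonempty V] {H : PLGraph} (hH : H.graph = ⊥) : H.density G φ = 1 := by
  have hc : Nat.card {h : H.U → V // H.IsHom G φ h} = Fintype.card V ^ Fintype.card H.U := by
    classical
    have hall : ∀ h : H.U → V, H.IsHom G φ h := fun h u v huv => by
      rw [hH] at huv
      exact huv.elim
    rw [Nat.card_congr (Equiv.subtypeUnivEquiv hall), Nat.card_eq_fintype_card, Fintype.card_fun]
  have hV : (Fintype.card V : ℝ) ≠ 0 := by exact_mod_cast Fintype.card_ne_zero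
  rw [density, hc, Nat.cast_pow, div_self (pow_ne_zero _ hV)]

end density

end PLGraph

/-- `𝓕`: the partially labeled graphs up to label-preserving isomorphism. -/
def 𝓕 : Type 1 := Quotient PLGraph.setoid

namespace 𝓕

/-- The isomorphism class of a partially labeled graph. -/
def mk (H : PLGraph) : 𝓕 := Quotient.mk PLGraph.setoid H

theorem mk_eq {H H' : PLGraph} (h : H.Iso H') : mk H = mk H' :=
  Quotient.sound (s := PLGraph.setoid) h

/-- Classes of partially labeled graphs form a commutative monoid under the gluing product. -/
instance : CommMonoid 𝓕 where
  mul := Quotient.map₂ PLGraph.mul fun _ _ h₁ _ _ h₂ => PLGraph.mul_congr h₁ h₂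
  one := mk PLGraph.empty
  mul_assoc := by
    rintro ⟨a⟩ ⟨b⟩ ⟨c⟩
    exact mk_eq (PLGraph.mul_assoc_iso a b c)
  mul_comm := by
    rintro ⟨a⟩ ⟨b⟩
    exact mk_eq (PLGraph.mul_comm_iso a b)
  one_mul := by
    rintro ⟨a⟩
    have : IsEmpty PLGraph.empty.U := inferInstanceAs (IsEmpty Empty)
    exact mk_eq ((PLGraph.mul_comm_iso _ _).trans
      (PLGraph.mul_iso_self a PLGraph.empty rfl (Finset.empty_subset _)))
  mul_one := by
    rintro ⟨a⟩
    have : IsEmpty PLGraph.empty.U := inferInstanceAs (IsEmpty Empty)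
    exact mk_eq (PLGraph.mul_iso_self a PLGraph.empty rfl (Finset.empty_subset _))

theorem mk_mul (H H' : PLGraph) : mk H * mk H' = mk (PLGraph.mul H H') := rfl

theorem one_def : (1 : 𝓕) = mk PLGraph.empty := rfl

/-- Removing all labels. -/
def unlabel : 𝓕 → 𝓕 := Quotient.map PLGraph.unlabel fun _ _ h => PLGraph.unlabel_congr h

/-- `t(·; G, φ)` on `𝓕`; it is multiplicative. -/
def density {V : Type} [Fintype V] [Nonempty V] (G : SimpleGraph V) (φ : ℕ → V) : 𝓕 →* ℝ where
  toFun := Quotient.lift (fun H : PLGraph => H.density G φ) fun _ _ h => PLGraph.density_congr G φ h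
  map_one' := PLGraph.density_of_bot G φ (H := PLGraph.empty) rfl
  map_mul' := by
    rintro ⟨a⟩ ⟨b⟩
    exact PLGraph.density_mul G φ a b

end 𝓕

/-- The labeled quantum graphs `ℝ[𝓕]`: formal real linear combinations of partially labeled
graphs, with the product extended bilinearly. -/
abbrev LQG : Type 1 := MonoidAlgebra ℝ 𝓕

/-- A partially labeled graph as an element of `ℝ[𝓕]`. -/
def toLQG (H : PLGraph) : LQG := MonoidAlgebra.of ℝ 𝓕 (𝓕.mk H)

/-- The possibly labeled graphs with exactly one vertex. -/
def points : Set PLGraph :=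
  insert PLGraph.unlabeledPoint (Set.range PLGraph.labeledPoint)

/-- The ideal `𝓚` of `ℝ[𝓕]` generated by the elements `F - ∅` with `F` a possibly labeled graph
with one vertex. -/
def 𝓚 : Ideal LQG := Ideal.span ((fun F => toLQG F - toLQG PLGraph.empty) '' points)

/-- The quotient algebra `𝓐 = ℝ[𝓕] / 𝓚`. -/
abbrev 𝓐 : Type 1 := LQG ⧸ 𝓚

/-- The quotient map `ℝ[𝓕] → 𝓐`. -/
def toA : LQG →ₐ[ℝ] 𝓐 := Ideal.Quotient.mkₐ ℝ 𝓚

theorem toLQG_mul (H H' : PLGraph) : toLQG H * toLQG H' = toLQG (PLGraph.mul H H') :=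
  ((MonoidAlgebra.of ℝ 𝓕).map_mul _ _).symm

theorem toLQG_empty : toLQG PLGraph.empty = 1 := (MonoidAlgebra.of ℝ 𝓕).map_one

theorem toLQG_eq {H H' : PLGraph} (h : H.Iso H') : toLQG H = toLQG H' :=
  congrArg (MonoidAlgebra.of ℝ 𝓕) (𝓕.mk_eq h)

section density

variable {V : Type} [Fintype V] [Nonempty V] (G : SimpleGraph V) (φ : ℕ → V)

/-- `t(f; G, φ)` for `f ∈ ℝ[𝓕]`, by linearity. -/
def tLQG : LQG →ₐ[ℝ] ℝ := MonoidAlgebra.lift ℝ ℝ 𝓕 (𝓕.density G φ)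

theorem tLQG_toLQG (H : PLGraph) : tLQG G φ (toLQG H) = H.density G φ := by
  rw [tLQG, toLQG, MonoidAlgebra.lift_of]
  rfl

theorem tLQG_eq_zero (f : LQG) (hf : f ∈ 𝓚) : tLQG G φ f = 0 := by
  have h : 𝓚 ≤ RingHom.ker (tLQG G φ) := by
    refine Ideal.span_le.2 ?_
    rintro _ ⟨F, hF, rfl⟩
    have hb : F.graph = ⊥ := by
      rcases hF with rfl | ⟨a, rfl⟩ <;> rfl
    rw [SetLike.mem_coe, RingHom.mem_ker, map_sub, tLQG_toLQG, tLQG_toLQG,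
      PLGraph.density_of_bot G φ hb, PLGraph.density_of_bot G φ (H := PLGraph.empty) rfl, sub_self]
  exact h hf

/-- `t(x; G, φ)` for `x ∈ 𝓐`. -/
def t : 𝓐 →ₐ[ℝ] ℝ := Ideal.Quotient.liftₐ 𝓚 (tLQG G φ) (tLQG_eq_zero G φ)

end density

/-- The map `⟦·⟧` on `ℝ[𝓕]` that removes all labels. -/
def unlabelLQG : LQG →ₗ[ℝ] LQG := MonoidAlgebra.mapDomainLinearMap ℝ ℝ 𝓕.unlabel

theorem unlabelLQG_toLQG (H : PLGraph) : unlabelLQG (toLQG H) = toLQG H.unlabel := by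
  rw [unlabelLQG, toLQG, MonoidAlgebra.of_apply, MonoidAlgebra.mapDomainLinearMap_single]
  rfl

theorem unlabelLQG_mem (f : LQG) (hf : f ∈ 𝓚) : unlabelLQG f ∈ 𝓚 := by
  have key : ∀ F ∈ points, ∀ H : PLGraph,
      unlabelLQG (toLQG H * (toLQG F - toLQG PLGraph.empty)) ∈ 𝓚 := by
    intro F hF H
    have hgen : ∀ H : PLGraph, toLQG (PLGraph.mul H PLGraph.unlabeledPoint) - toLQG H ∈ 𝓚 := by
      intro H
      have h : toLQG (PLGraph.mul H PLGraph.unlabeledPoint) - toLQG H =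
          toLQG H * (toLQG PLGraph.unlabeledPoint - toLQG PLGraph.empty) := by
        rw [mul_sub, toLQG_mul, toLQG_empty, mul_one]
      rw [h]
      exact 𝓚.mul_mem_left _ (Ideal.subset_span ⟨_, Or.inl rfl, rfl⟩)
    rw [mul_sub, toLQG_mul, toLQG_empty, mul_one, map_sub, unlabelLQG_toLQG, unlabelLQG_toLQG]
    rcases hF with rfl | ⟨a, rfl⟩
    · rw [toLQG_eq (PLGraph.unlabel_mul_unlabeledPoint H)]
      exact hgen _
    · by_cases ha : a ∈ H.labels
      · have : IsEmpty (PLGraph.labeledPoint a).U := inferInstanceAs (IsEmpty Empty)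
        rw [toLQG_eq (PLGraph.unlabel_congr (PLGraph.mul_iso_self H (PLGraph.labeledPoint a) rfl
          (Finset.singleton_subset_iff.2 ha))), sub_self]
        exact 𝓚.zero_mem
      · rw [toLQG_eq (PLGraph.unlabel_mul_labeledPoint H a ha)]
        exact hgen _
  have key2 : ∀ g : LQG, ∀ F ∈ points,
      unlabelLQG (g * (toLQG F - toLQG PLGraph.empty)) ∈ 𝓚 := by
    intro g F hF
    induction g using MonoidAlgebra.induction_on with
    | of m =>
      obtain ⟨H, rfl⟩ := Quotient.exists_rep m
      exact key F hF H
    | add f g hf hg =>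
      rw [add_mul, map_add]
      exact 𝓚.add_mem hf hg
    | smul r f hf =>
      rw [smul_mul_assoc, map_smul, Algebra.smul_def]
      exact 𝓚.mul_mem_left _ hf
  refine Submodule.span_induction (p := fun f _ => ∀ g : LQG, unlabelLQG (g * f) ∈ 𝓚)
    ?_ ?_ ?_ ?_ hf 1 |> fun h => by simpa using h
  · rintro _ ⟨F, hF, rfl⟩ g
    exact key2 g F hF
  · intro g
    rw [mul_zero, map_zero]
    exact 𝓚.zero_mem
  · intro x y _ _ hx hy g
    rw [mul_add, map_add]
    exact 𝓚.add_mem (hx g) (hy g)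
  · intro a x _ hx g
    rw [smul_eq_mul, ← mul_assoc]
    exact hx _

/-- The map `⟦·⟧ : 𝓐 → 𝓐` induced by removing all labels. -/
def unlabel : 𝓐 →ₗ[ℝ] 𝓐 :=
  Submodule.mapQ (𝓚.restrictScalars ℝ) (𝓚.restrictScalars ℝ) unlabelLQG unlabelLQG_mem

/-- The image in `𝓐` of the span of the graphs without labels. Its elements are the quantum
graphs, modulo adding or removing isolated vertices. -/
def 𝓐₀ : Submodule ℝ 𝓐 :=
  (Submodule.span ℝ {f : LQG | ∃ H : PLGraph, H.labels = ∅ ∧ f = toLQG H}).map toA.toLinearMap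

/-- Positivity: `t(x; G, φ) ≥ 0` for every finite graph `G` with at least one vertex and every
map `φ` of the labels to the vertices of `G`. If `x ∈ 𝓐₀`, then `t(x; G, φ)` does not depend
on `φ`. -/
def IsPositive (x : 𝓐) : Prop :=
  ∀ (V : Type) [Fintype V] [Nonempty V] (G : SimpleGraph V) (φ : ℕ → V), 0 ≤ t G φ x

/-- `x = ⟦g₁² + ⋯ + gₘ²⟧` for finitely many `g₁, …, gₘ ∈ 𝓐`. -/
def IsExpressibleAsSOS (x : 𝓐) : Prop :=
  ∃ (m : ℕ) (g : Fin m → 𝓐), x = unlabel (∑ i, g i ^ 2)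

open Classical in
/-- `ind(H) = ∑ (-1)^|E(F) \ E(H)| F`, over all graphs `F ⊇ H` on the vertex set of `H`. -/
def ind (H : PLGraph) : LQG :=
  ∑ Γ ∈ (Finset.univ : Finset (SimpleGraph H.Vert)).filter (fun Γ => H.graph ≤ Γ),
    (-1 : ℝ) ^ (Γ.edgeSet \ H.graph.edgeSet).ncard • toLQG ⟨H.labels, H.U, Γ⟩

section phi

variable {k : ℕ} (H : SimpleGraph (Fin k))

/-- The fully labeled graph `H`, its vertex `i` with label `i`, and one more unlabeled vertex that
is a clone of the vertex `j`: it is adjacent exactly to the neighbors of `j`. -/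
def cloneGraph (j : Fin k) : PLGraph where
  labels := Finset.range k
  U := Unit
  graph := H.comap (Sum.elim (fun a : Finset.range k => (⟨a.1, Finset.mem_range.1 a.2⟩ : Fin k))
    (fun _ => j))

/-- The same graph with an additional edge between `j` and its clone. -/
def cloneGraph' (j : Fin k) : PLGraph where
  labels := Finset.range k
  U := Unit
  graph := (cloneGraph H j).graph ⊔
    SimpleGraph.edge (Sum.inl ⟨j.1, Finset.mem_range.2 j.2⟩) (Sum.inr ())

/-- The algebra homomorphism `φ_H : ℝ[x₁, …, x_k] → 𝓐` that maps `x_j` to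
`ind(H_j) + ind(H_j')`. -/
def phi : MvPolynomial (Fin k) ℝ →ₐ[ℝ] 𝓐 :=
  MvPolynomial.aeval fun j => toA (ind (cloneGraph H j) + ind (cloneGraph' H j))

end phi

/-- A set `W` of vertices is homogeneous if all of its elements have the same neighbors outside
of `W`. -/
def IsHomogeneousSet {V : Type} (H : SimpleGraph V) (W : Set V) : Prop :=
  ∀ u ∈ W, ∀ v ∈ W, H.neighborSet u \ W = H.neighborSet v \ W

/-- A graph is stringent if it has no homogeneous set `W` with `1 < |W| ≤ |V(H)| - 1` and no
automorphism other than the identity. -/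
def IsStringent {V : Type} [Fintype V] (H : SimpleGraph V) : Prop :=
  (∀ W : Set V, 1 < W.ncard → W.ncard < Fintype.card V → ¬ IsHomogeneousSet H W) ∧
    ∀ e : H ≃g H, ∀ v, e v = v

section forms

variable {k : ℕ}

/-- A form: a homogeneous polynomial of some degree. -/
def IsForm (p : MvPolynomial (Fin k) ℝ) : Prop := ∃ d, p.IsHomogeneous d

/-- `P_k`: the forms that are nonnegative on `ℝ^k`. -/
def IsPositiveForm (p : MvPolynomial (Fin k) ℝ) : Prop :=
  IsForm p ∧ ∀ y : Fin k → ℝ, 0 ≤ MvPolynomial.eval y p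

/-- `Σ_k`: the forms that are sums of squares of polynomials. -/
def IsSOSForm (p : MvPolynomial (Fin k) ℝ) : Prop := IsForm p ∧ IsSumSq p

/-- `y` is a bad point for `p`: every polynomial `q` with `q² p ∈ Σ_k` vanishes at `y`. -/
def IsBadPoint (p : MvPolynomial (Fin k) ℝ) (y : Fin k → ℝ) : Prop :=
  ∀ q : MvPolynomial (Fin k) ℝ, IsSOSForm (q ^ 2 * p) → MvPolynomial.eval y q = 0

/-- The even polynomial `x₁² x₂² ⋯ x_k² p(x₁², …, x_k²)`. -/
def evenLift (p : MvPolynomial (Fin k) ℝ) : MvPolynomial (Fin k) ℝ :=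
  (∏ i, MvPolynomial.X i ^ 2) * MvPolynomial.expand 2 p

/-- `p` is a form, and `x₁² ⋯ x_k² p(x₁², …, x_k²)` is a nonnegative form that is not a sum of
squares and has `(1, 0, …, 0)` as a bad point. -/
def IsBadPointForm (p : MvPolynomial (Fin k) ℝ) : Prop :=
  IsForm p ∧ IsPositiveForm (evenLift p) ∧ ¬ IsSOSForm (evenLift p) ∧
    IsBadPoint (evenLift p) (fun i => if i.1 = 0 then 1 else 0)

end forms

end QuantumGraph

end

/-! Positivity. For fixed images of the labels, the density is an algebra homomorphism and sends
φ_H(p) to p evaluated at sums of induced densities, which are nonnegative. Since the even lift of p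
is nonnegative, p is nonnegative on the nonnegative orthant, and removing labels only averages over
their images.

No sum of squares. Take H itself as target, with real vertex weights x of sum 1 in place of the
uniform distribution. Stringency makes every induced self-map of H the identity and forces the clone
of j onto j. So the image of x_j under φ_H has density x_j if all labels sit on their own vertices,
and 0 otherwise (`wLQG_clone`). As p(0) = 0, the density of ⟦φ_H(p)⟧ is x₁⋯x_k p(x). A
representation as a sum of squares would rewrite this, on Σ xᵢ = 1, as a sum of squares of
polynomials with monomial weights ∏ x_ψ(a). Substitute xᵢ = yᵢ²/σ with σ = Σ yⱼ²: the weights become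
squares, and after clearing denominators an even power of σ times the even lift is a sum of squares.
But σ = 1 at (1,0,…,0), which was a bad point (`not_isBadPointForm_of_simplex`).

Existence. The Motzkin form in variables other than the first yields an admissible p, because
expansion near (1,0,…,0) would turn a sum of squares for q²P with q(1,0,…,0) ≠ 0 into one for a
positive multiple of the Motzkin polynomial. An asymmetric graph on six vertices serves as H. -/

section SumsOfSquares

/-! ### Sums of squares of polynomials over formally real rings -/

theorem IsSumSq.exists_sum_sq {R : Type*} [CommSemiring R] {a : R} (h : IsSumSq a) :
    ∃ (n : ℕ) (f : Fin n → R), a = ∑ i, f i ^ 2 := by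
  induction h with
  | zero => exact ⟨0, Fin.elim0, by simp⟩
  | sq_add b _ ih =>
    obtain ⟨n, f, rfl⟩ := ih
    exact ⟨n + 1, Fin.cons b f, by simp [Fin.sum_univ_succ, sq]⟩

variable {R ι : Type*} [CommRing R] [IsFormallyReal R]

theorem eq_zero_of_sum_sq_eq_zero {s : Finset ι} {f : ι → R} (h : ∑ i ∈ s, f i ^ 2 = 0) :
    ∀ i ∈ s, f i = 0 := by
  classical
  intro i hi
  rw [← Finset.add_sum_erase s _ hi, sq] at h
  have h0 : f i * f i = 0 := IsFormallyReal.eq_zero_of_add_right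
    (IsSumSq.mul_self _) (IsSumSq.sum_sq _ _) h
  exact pow_eq_zero_iff two_ne_zero |>.1 ((sq _).trans h0)

namespace Polynomial

/-- Leading terms cannot cancel: the coefficient at twice the largest degree is a sum of squares,
not all of them zero. -/
theorem natDegree_le_of_sum_sq {s : Finset ι} {N : ℕ} {f : ι → R[X]}
    (h : (∑ i ∈ s, f i ^ 2).natDegree ≤ 2 * N) : ∀ i ∈ s, (f i).natDegree ≤ N := by
  intro i₀ hi₀
  obtain ⟨j, hj, hmax⟩ := s.exists_max_image (fun i => (f i).natDegree) ⟨i₀, hi₀⟩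
  refine (hmax i₀ hi₀).trans ?_
  by_contra! hN
  have hc : ∑ i ∈ s, (f i).coeff (f j).natDegree ^ 2 = 0 := by
    rw [← coeff_eq_zero_of_natDegree_lt (p := ∑ i ∈ s, f i ^ 2) (n := 2 * (f j).natDegree)
      (by omega), finsetSum_coeff]
    exact Finset.sum_congr rfl fun i hi => (coeff_pow_of_natDegree_le (hmax i hi)).symm
  have := eq_zero_of_sum_sq_eq_zero hc j hj
  rw [coeff_natDegree, leadingCoeff_eq_zero] at this
  simp [this] at hN

variable [IsDomain R]

/-- The squares of the constant terms add up to 0, so each constant term vanishes; divide by X² and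
induct. -/
theorem X_pow_dvd_of_dvd_sum_sq {s : Finset ι} {N : ℕ} {f : ι → R[X]}
    (h : X ^ (2 * N) ∣ ∑ i ∈ s, f i ^ 2) : ∀ i ∈ s, X ^ N ∣ f i := by
  induction N generalizing f with
  | zero => simp
  | succ N ih =>
    have h0 : ∀ i ∈ s, (f i).coeff 0 = 0 := by
      refine eq_zero_of_sum_sq_eq_zero ?_
      have := X_pow_dvd_iff.1 h 0 (by omega)
      simpa [finsetSum_coeff, sq, mul_coeff_zero] using this
    have hf : ∀ i ∈ s, f i = X * (f i).divX := fun i hi => by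
      conv_lhs => rw [← X_mul_divX_add (f i), h0 i hi, C_0, add_zero]
    have hs : ∑ i ∈ s, f i ^ 2 = X ^ 2 * ∑ i ∈ s, (f i).divX ^ 2 := by
      rw [Finset.mul_sum]
      refine Finset.sum_congr rfl fun i hi => ?_
      conv_lhs => rw [hf i hi, mul_pow]
    rw [hs, mul_add, mul_one, add_comm, pow_add,
      mul_dvd_mul_iff_left (pow_ne_zero 2 X_ne_zero)] at h
    intro i hi
    rw [hf i hi, pow_succ']
    exact mul_dvd_mul_left _ (ih h i hi)

/-- A vanishing sum of squares is divisible by every power of X, hence so is each summand. The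
instance iterates, which gives the two- and three-variable rings used for the Motzkin polynomial. -/
instance isFormallyReal : IsFormallyReal R[X] := by
  refine .of_eq_zero_of_mul_self_of_eq_zero_of_add (fun {a} ha => by simpa using ha)
    fun {s₁ s₂} h₁ h₂ h => ?_
  obtain ⟨n₁, f₁, rfl⟩ := h₁.exists_sum_sq
  obtain ⟨n₂, f₂, rfl⟩ := h₂.exists_sum_sq
  have hd : ∀ i, Sum.elim f₁ f₂ i = 0 := by
    intro i
    by_contra hi
    have hX := X_pow_dvd_of_dvd_sum_sq (s := Finset.univ) (f := Sum.elim f₁ f₂)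
      (N := (Sum.elim f₁ f₂ i).natDegree + 1) (by simp [h]) i (Finset.mem_univ i)
    exact hi (leadingCoeff_eq_zero.1 (X_pow_dvd_iff.1 hX _ (Nat.lt_succ_self _)))
  exact Finset.sum_eq_zero fun i _ => by simpa using hd (Sum.inl i)

theorem exists_eq_sum_sq_of_X_pow_mul {n N : ℕ} {p : R[X]} {f : Fin n → R[X]}
    (h : X ^ (2 * N) * p = ∑ i, f i ^ 2) : ∃ g : Fin n → R[X], p = ∑ i, g i ^ 2 := by
  choose g hg using fun i => X_pow_dvd_of_dvd_sum_sq (Dvd.intro _ h) i (Finset.mem_univ i)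
  refine ⟨g, mul_left_cancel₀ (pow_ne_zero (2 * N) X_ne_zero) ?_⟩
  rw [h, Finset.mul_sum]
  exact Finset.sum_congr rfl fun i _ => by rw [hg, mul_pow, ← pow_mul, mul_comm N]

/-- No positive multiple of the Motzkin polynomial `x⁴y² + x²y⁴ + 1 - 3x²y²` is a sum of squares. -/
theorem motzkin_ne_sum_sq {s : Finset ι} {c : ℝ} (hc : c ≠ 0) (f : ι → ℝ[X][X]) :
    ∑ i ∈ s, f i ^ 2 ≠ C (C c) ^ 2 * (C X ^ 4 * X ^ 2 + C X ^ 2 * X ^ 4 + 1 - 3 * C X ^ 2 * X ^ 2) := by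
  intro h
  have hM : C (C c) ^ 2 * (C X ^ 4 * X ^ 2 + C X ^ 2 * X ^ 4 + 1 - 3 * C X ^ 2 * X ^ 2) =
      C (C c ^ 2 * X ^ 2) * X ^ 4 + C (C c ^ 2 * (X ^ 4 - 3 * X ^ 2)) * X ^ 2 + C (C (c ^ 2)) := by
    simp only [map_mul, map_pow, map_sub, map_ofNat]
    ring
  rw [hM] at h
  have hdeg : ∀ i ∈ s, (f i).natDegree ≤ 2 := by
    refine natDegree_le_of_sum_sq ?_
    rw [h]
    compute_degree
  have hf : ∀ i ∈ s, f i = C ((f i).coeff 2) * X ^ 2 + C ((f i).coeff 1) * X + C ((f i).coeff 0) :=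
    fun i hi => eq_quadratic_of_degree_le_two (natDegree_le_iff_degree_le.1 (hdeg i hi))
  have hsq : ∀ i ∈ s, f i ^ 2 = C ((f i).coeff 2 ^ 2) * X ^ 4 +
      C (2 * (f i).coeff 2 * (f i).coeff 1) * X ^ 3 +
      C ((f i).coeff 1 ^ 2 + 2 * (f i).coeff 2 * (f i).coeff 0) * X ^ 2 +
      C (2 * (f i).coeff 0 * (f i).coeff 1) * X + C ((f i).coeff 0 ^ 2) := by
    intro i hi
    conv_lhs => rw [hf i hi]
    simp only [map_mul, map_pow, map_add, map_ofNat]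
    ring
  rw [Finset.sum_congr rfl hsq] at h
  have h4 : ∑ i ∈ s, (f i).coeff 2 ^ 2 = C c ^ 2 * X ^ 2 := by
    simpa [finsetSum_coeff, coeff_X, coeff_C, -map_mul, -map_pow, -map_add, -map_sub]
      using congrArg (fun p => coeff p 4) h
  have h2 : ∑ i ∈ s, ((f i).coeff 1 ^ 2 + 2 * (f i).coeff 2 * (f i).coeff 0) =
      C c ^ 2 * (X ^ 4 - 3 * X ^ 2) := by
    simpa [finsetSum_coeff, coeff_X, coeff_C, -map_mul, -map_pow, -map_add, -map_sub]
      using congrArg (fun p => coeff p 2) h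
  have h0 : ∑ i ∈ s, (f i).coeff 0 ^ 2 = C (c ^ 2) := by
    simpa [finsetSum_coeff, coeff_X, coeff_C, -map_mul, -map_pow, -map_add, -map_sub]
      using congrArg (fun p => coeff p 0) h
  clear h hsq hf hM
  -- Write f = D y² + B y + A with coefficients in ℝ[x]. Then A is constant, D is a multiple of x,
  -- and B has no constant term. The x² coefficient of Σ (B² + 2DA) is therefore a sum of real
  -- squares, yet it must equal -3c².
  have hA : ∀ i ∈ s, ((f i).coeff 0).natDegree ≤ 0 :=
    natDegree_le_of_sum_sq (by rw [h0, natDegree_C])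
  have hD : ∀ i ∈ s, ((f i).coeff 2).natDegree ≤ 1 :=
    natDegree_le_of_sum_sq (by rw [h4, ← C_pow]; exact natDegree_C_mul_X_pow_le _ _)
  have hD0 : ∀ i ∈ s, ((f i).coeff 2).coeff 0 = 0 := by
    refine eq_zero_of_sum_sq_eq_zero ?_
    simpa [finsetSum_coeff, coeff_zero_eq_eval_zero, eval_finsetSum] using congrArg (fun p => coeff p 0) h4
  have hB0 : ∀ i ∈ s, ((f i).coeff 1).coeff 0 = 0 := by
    refine eq_zero_of_sum_sq_eq_zero ?_
    have := congrArg (fun p => coeff p 0) h2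
    simp only [finsetSum_coeff, sq, coeff_add, mul_coeff_zero, coeff_sub] at this
    rw [Finset.sum_congr rfl fun i hi => by rw [hD0 i hi, mul_zero, zero_mul, add_zero]] at this
    simpa [sq] using this
  have h22 := congrArg (fun p => coeff p 2) h2
  have hterm : ∀ i ∈ s, coeff ((f i).coeff 1 ^ 2 + 2 * (f i).coeff 2 * (f i).coeff 0) 2 =
      ((f i).coeff 1).coeff 1 ^ 2 := by
    intro i hi
    have e1 : ((f i).coeff 2).coeff 2 = 0 :=
      coeff_eq_zero_of_natDegree_lt (by have := hD i hi; omega)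
    rw [eq_C_of_natDegree_le_zero (hA i hi), coeff_add, coeff_mul_C, ← C_ofNat, coeff_C_mul, e1, sq,
      coeff_mul, Finset.Nat.sum_antidiagonal_eq_sum_range_succ_mk]
    simp [Finset.sum_range_succ, hB0 i hi, sq]
  rw [finsetSum_coeff, Finset.sum_congr rfl hterm, ← C_pow, coeff_C_mul] at h22
  have hneg : (X ^ 4 - 3 * X ^ 2 : ℝ[X]).coeff 2 = -3 := by
    rw [← C_ofNat, coeff_sub, coeff_C_mul]
    simp [coeff_X_pow]
  rw [hneg] at h22
  have : 0 ≤ ∑ i ∈ s, ((f i).coeff 1).coeff 1 ^ 2 := Finset.sum_nonneg fun i _ => sq_nonneg _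
  have := sq_pos_of_ne_zero hc
  nlinarith

end Polynomial

end SumsOfSquares

namespace QuantumGraph

open MvPolynomial

/-! ### An admissible form and a stringent graph -/

section example_form

/-- The form whose even lift is `x₁² ⋯ x₆²` times the Motzkin form in the second, third and fourth
variable. -/
noncomputable def motzkinForm : MvPolynomial (Fin 6) ℝ :=
  X 1 ^ 2 * X 2 + X 1 * X 2 ^ 2 + X 3 ^ 3 - 3 * X 1 * X 2 * X 3

theorem isForm_motzkinForm : IsForm motzkinForm := by
  have h1 : (X 1 ^ 2 * X 2 : MvPolynomial (Fin 6) ℝ).IsHomogeneous 3 :=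
    (isHomogeneous_X_pow 1 2).mul (isHomogeneous_X ℝ 2)
  have h2 : (X 1 * X 2 ^ 2 : MvPolynomial (Fin 6) ℝ).IsHomogeneous 3 :=
    (isHomogeneous_X ℝ 1).mul (isHomogeneous_X_pow 2 2)
  have h3 : (X 3 ^ 3 : MvPolynomial (Fin 6) ℝ).IsHomogeneous 3 := isHomogeneous_X_pow 3 3
  have h4 : (C 3 * X 1 * X 2 * X 3 : MvPolynomial (Fin 6) ℝ).IsHomogeneous 3 :=
    (((isHomogeneous_C (Fin 6) (3 : ℝ)).mul (isHomogeneous_X ℝ 1)).mul (isHomogeneous_X ℝ 2)).mul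
      (isHomogeneous_X ℝ 3)
  exact ⟨3, ((h1.add h2).add h3).sub h4⟩

/-- This is the arithmetic-geometric mean inequality for a²b, ab² and c³. -/
theorem motzkin_nonneg {a b c : ℝ} (ha : 0 ≤ a) (hb : 0 ≤ b) (hc : 0 ≤ c) :
    0 ≤ a ^ 2 * b + a * b ^ 2 + c ^ 3 - 3 * a * b * c := by
  have hab := mul_nonneg ha hb
  rcases le_total (3 * c) (a + b) with h | h
  · nlinarith [mul_nonneg hab (sub_nonneg.2 h), pow_nonneg hc 3]
  -- Four times the expression is (a-b)²(3c-a-b) + (a+b-2c)²(a+b+c).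
  · nlinarith [mul_nonneg (sq_nonneg (a - b)) (sub_nonneg.2 h),
      mul_nonneg (sq_nonneg (a + b - 2 * c)) (add_nonneg (add_nonneg ha hb) hc)]

theorem isHomogeneous_evenLift {k d : ℕ} {p : MvPolynomial (Fin k) ℝ} (hp : p.IsHomogeneous d) :
    (evenLift p).IsHomogeneous (2 * k + 2 * d) := by
  refine IsHomogeneous.mul ?_ ?_
  · have := IsHomogeneous.prod (R := ℝ) (Finset.univ : Finset (Fin k)) (fun i => X i ^ 2) (fun _ => 2)
      fun i _ => isHomogeneous_X_pow i 2
    simpa [mul_comm] using this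
  · have := IsHomogeneous.aeval hp (fun i => (X i ^ 2 : MvPolynomial (Fin k) ℝ))
      fun i => isHomogeneous_X_pow i 2
    exact this

theorem eval_evenLift {k : ℕ} (p : MvPolynomial (Fin k) ℝ) (y : Fin k → ℝ) :
    eval y (evenLift p) = (∏ i, y i ^ 2) * eval (fun i => y i ^ 2) p := by
  rw [evenLift, map_mul, map_prod]
  congr 1
  · simp
  · rw [expand, ← aeval_eq_eval, ← aeval_eq_eval]
    exact (DFunLike.congr_fun (algHom_ext (f := (aeval y).comp (bind₁ fun i => X i ^ 2))
      (g := aeval fun i => y i ^ 2) fun i => by simp) p)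

theorem isPositiveForm_evenLift_motzkinForm : IsPositiveForm (evenLift motzkinForm) := by
  obtain ⟨d, hd⟩ := isForm_motzkinForm
  refine ⟨⟨_, isHomogeneous_evenLift hd⟩, fun y => ?_⟩
  rw [eval_evenLift]
  refine mul_nonneg (Finset.prod_nonneg fun i _ => sq_nonneg _) ?_
  simpa [motzkinForm] using motzkin_nonneg (sq_nonneg (y 1)) (sq_nonneg (y 2)) (sq_nonneg (y 3))

open Polynomial in
-- Restrict to points (1, ta, tb, t, t, t), which tend to (1,0,…,0) as t → 0. After division by a
-- power of t, the limit keeps only the value c of q at the bad point, times a²b² and the Motzkin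
-- polynomial in a and b.
theorem isBadPoint_evenLift_motzkinForm :
    IsBadPoint (evenLift motzkinForm) (fun i => if i.1 = 0 then 1 else 0) := by
  intro q hq
  by_contra hc
  set c := MvPolynomial.eval (fun i : Fin 6 => if i.1 = 0 then (1 : ℝ) else 0) q
  let a : ℝ[X][X][X] := .C (.C .X)
  let b : ℝ[X][X][X] := .C .X
  let t : ℝ[X][X][X] := .X
  let ρ : MvPolynomial (Fin 6) ℝ →ₐ[ℝ] ℝ[X][X][X] :=
    MvPolynomial.aeval ![1, t * a, t * b, t, t, t]
  obtain ⟨n, f, hf⟩ := hq.2.exists_sum_sq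
  -- Of the factor t¹⁶, ten come from the squared variables and six from the degree of the Motzkin
  -- form.
  have hP : ρ (evenLift motzkinForm) = .X ^ (2 * 8) * .C (.C .X ^ 2 * (.X ^ 2 *
      (.C .X ^ 4 * .X ^ 2 + .C .X ^ 2 * .X ^ 4 + 1 - 3 * .C .X ^ 2 * .X ^ 2))) := by
    simp [ρ, evenLift, motzkinForm, Fin.prod_univ_succ]
    simp only [a, b, t, show (.C 3 : ℝ[X][X][X]) = 3 from rfl]
    ring
  have hρ : (.X : ℝ[X][X][X]) ^ (2 * 8) * (ρ q ^ 2 * .C (.C .X ^ 2 * (.X ^ 2 *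
      (.C .X ^ 4 * .X ^ 2 + .C .X ^ 2 * .X ^ 4 + 1 - 3 * .C .X ^ 2 * .X ^ 2)))) =
      ∑ i, ρ (f i) ^ 2 := by
    have := congrArg ρ hf
    rw [map_mul, map_pow, map_sum, hP] at this
    simp only [map_pow] at this
    rw [← this]
    ring
  obtain ⟨g, hρ⟩ := exists_eq_sum_sq_of_X_pow_mul hρ
  have hq0 : Polynomial.eval 0 (ρ q) = .C (.C c) := by
    have : ((Polynomial.aeval (0 : ℝ[X][X])).restrictScalars ℝ).comp ρ =
        (Algebra.ofId ℝ ℝ[X][X]).comp (MvPolynomial.aeval (fun i : Fin 6 => if i.1 = 0 then (1 : ℝ) else 0)) := by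
      ext i : 1
      fin_cases i <;> simp [ρ, t]
    exact DFunLike.congr_fun this q
  have h1 := congrArg (Polynomial.eval 0) hρ
  simp only [Polynomial.eval_mul, Polynomial.eval_pow, hq0, Polynomial.eval_C,
    Polynomial.eval_finsetSum] at h1
  have h1' : (.X : ℝ[X][X]) ^ (2 * 1) * (.C .X ^ 2 * (.C (.C c) ^ 2 *
      (.C .X ^ 4 * .X ^ 2 + .C .X ^ 2 * .X ^ 4 + 1 - 3 * .C .X ^ 2 * .X ^ 2))) =
      ∑ i, Polynomial.eval 0 (g i) ^ 2 := by
    rw [← h1]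
    ring
  obtain ⟨g', h2⟩ := exists_eq_sum_sq_of_X_pow_mul h1'
  -- The variable a lies in the coefficient ring, so it is divided out by setting it to 0 in all
  -- coefficients: the squares then sum to 0.
  have hdvd : ∀ i, ∃ g'', g' i = .C .X * g'' := by
    have h3 := congrArg (Polynomial.mapRingHom (Polynomial.evalRingHom (0 : ℝ))) h2
    rw [map_sum, map_mul, map_pow] at h3
    simp only [Polynomial.coe_mapRingHom, Polynomial.map_C, Polynomial.coe_evalRingHom,
      Polynomial.eval_X, map_zero, Polynomial.map_pow, zero_pow two_ne_zero, zero_mul] at h3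
    intro i
    refine (Polynomial.C_dvd_iff_dvd_coeff _ _).2 fun j => ?_
    have := congrArg (Polynomial.coeff · j) (eq_zero_of_sum_sq_eq_zero h3.symm i (Finset.mem_univ i))
    simpa [Polynomial.coeff_map, Polynomial.X_dvd_iff, Polynomial.coeff_zero_eq_eval_zero] using this
  choose g'' hg'' using hdvd
  simp only [hg'', mul_pow, ← Finset.mul_sum] at h2
  exact motzkin_ne_sum_sq hc g'' (mul_left_cancel₀ (pow_ne_zero _ (by simp)) h2).symm

theorem isBadPointForm_motzkinForm : IsBadPointForm motzkinForm := by
  refine ⟨isForm_motzkinForm, isPositiveForm_evenLift_motzkinForm, fun h => ?_, isBadPoint_evenLift_motzkinForm⟩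
  -- A sum of squares has no bad point, as q = 1 shows.
  have := isBadPoint_evenLift_motzkinForm 1 (by simpa using h)
  simp at this

/-- A triangle on `0, 2, 3` with the pendant edge `05` and the path `2, 1, 4` attached to it. -/
def asymmetricGraph : SimpleGraph (Fin 6) :=
  SimpleGraph.fromRel fun u v => (u, v) ∈
    ([(0, 2), (0, 3), (0, 5), (1, 2), (1, 4), (2, 3)] : List (Fin 6 × Fin 6))

instance : DecidableRel asymmetricGraph.Adj := fun u v =>
  inferInstanceAs (Decidable (u ≠ v ∧ (_ ∨ _)))

/-- The Boolean vector is the indicator of W, so that all 64 subsets are checked by evaluation. -/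
theorem asymmetricGraph_homogeneous : ∀ b₀ b₁ b₂ b₃ b₄ b₅ : Bool,
    (∀ u v w : Fin 6, ![b₀, b₁, b₂, b₃, b₄, b₅] u → ![b₀, b₁, b₂, b₃, b₄, b₅] v →
      ¬ ![b₀, b₁, b₂, b₃, b₄, b₅] w → (asymmetricGraph.Adj u w ↔ asymmetricGraph.Adj v w)) →
    (∀ u v, ![b₀, b₁, b₂, b₃, b₄, b₅] u → ![b₀, b₁, b₂, b₃, b₄, b₅] v → u = v) ∨
      ∀ u, ![b₀, b₁, b₂, b₃, b₄, b₅] u := by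
  decide

set_option synthInstance.maxHeartbeats 400000 in
set_option synthInstance.maxSize 2000 in
-- The only triangle is 0, 2, 3, and 3 has no neighbor outside it; of the other two, only 2 starts a
-- path of length two that leaves the triangle. The vertices are quantified along edges, each with
-- its constraint at once, to keep the search small.
theorem asymmetricGraph_aut : ∀ a₂ a₀ : Fin 6, asymmetricGraph.Adj a₂ a₀ →
    ∀ a₃, asymmetricGraph.Adj a₀ a₃ ∧ asymmetricGraph.Adj a₂ a₃ →
    ∀ a₅, asymmetricGraph.Adj a₀ a₅ ∧ a₅ ≠ a₂ ∧ a₅ ≠ a₃ →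
    ∀ a₁, asymmetricGraph.Adj a₂ a₁ ∧ a₁ ≠ a₀ ∧ a₁ ≠ a₃ →
    ∀ a₄, asymmetricGraph.Adj a₁ a₄ ∧ a₄ ≠ a₂ →
      a₀ = 0 ∧ a₁ = 1 ∧ a₂ = 2 ∧ a₃ = 3 ∧ a₄ = 4 ∧ a₅ = 5 := by
  decide

theorem isStringent_asymmetricGraph : IsStringent asymmetricGraph := by
  classical
  constructor
  · intro W h1 h2 hW
    have hb : ∀ u, ![decide (0 ∈ W), decide (1 ∈ W), decide (2 ∈ W), decide (3 ∈ W),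
        decide (4 ∈ W), decide (5 ∈ W)] u = true ↔ u ∈ W := by
      intro u
      fin_cases u <;> simp
    rcases asymmetricGraph_homogeneous (decide (0 ∈ W)) (decide (1 ∈ W)) (decide (2 ∈ W))
      (decide (3 ∈ W)) (decide (4 ∈ W)) (decide (5 ∈ W)) (by
        intro u v w hu hv hw
        rw [hb] at hu hv hw
        have := Set.ext_iff.1 (hW u hu v hv) w
        simpa [hw] using this) with h | h
    · simp only [hb] at h
      obtain ⟨u, v, hu, hv, huv⟩ := (Set.one_lt_ncard_iff W.toFinite).1 h1
      exact huv (h u v hu hv)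
    · simp only [hb] at h
      rw [Set.eq_univ_of_forall h, Set.ncard_univ, Nat.card_eq_fintype_card] at h2
      exact lt_irrefl _ h2
  · intro e
    have h : ∀ {u v}, asymmetricGraph.Adj u v → asymmetricGraph.Adj (e u) (e v) := e.map_adj_iff.2
    have h' : ∀ {u v}, u ≠ v → e u ≠ e v := e.injective.ne
    obtain ⟨h0, h1, h2, h3, h4, h5⟩ := asymmetricGraph_aut (e 2) (e 0) (h (by decide))
      (e 3) ⟨h (by decide), h (by decide)⟩ (e 5) ⟨h (by decide), h' (by decide), h' (by decide)⟩
      (e 1) ⟨h (by decide), h' (by decide), h' (by decide)⟩ (e 4) ⟨h (by decide), h' (by decide)⟩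
    intro v
    fin_cases v <;> assumption

end example_form

end QuantumGraph

namespace QuantumGraph

/-! ### Homomorphism densities for weighted target graphs -/

section marginal

variable {V : Type*} [Fintype V] {S : Type*} [CommSemiring S] {w : V → S}

theorem sum_prod_weight (hw : ∑ v, w v = 1) (C : Type*) [Fintype C] [DecidableEq C] :
    ∑ ψ : C → V, ∏ c, w (ψ c) = 1 := by
  classical
  have := Finset.prod_univ_sum (fun _ : C => (Finset.univ : Finset V)) fun _ v => w v
  simpa [hw, Fintype.piFinset_univ] using this.symm

/-- The marginal of a product measure: the coordinates outside the range of f contribute total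
weight 1. -/
theorem sum_prod_weight_comp (hw : ∑ v, w v = 1) {A B : Type*} [Fintype A] [Fintype B]
    [DecidableEq A] [DecidableEq B] {f : A → B} (hf : Function.Injective f) (F : (A → V) → S) :
    ∑ ψ : B → V, (∏ b, w (ψ b)) * F (ψ ∘ f) = ∑ ψ : A → V, (∏ a, w (ψ a)) * F ψ := by
  classical
  let e : A ⊕ ((Set.range f)ᶜ : Set B) ≃ B :=
    (Equiv.sumCongr (Equiv.ofInjective f hf) (Equiv.refl _)).trans (Equiv.Set.sumCompl (Set.range f))
  have he : ∀ a, e (Sum.inl a) = f a := fun a => rfl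
  rw [← ((Equiv.sumArrowEquivProdArrow _ _ _).symm.trans (Equiv.arrowCongr e (Equiv.refl V))).sum_comp,
    Fintype.sum_prod_type]
  refine Finset.sum_congr rfl fun α _ => ?_
  have h1 : ∀ β : ((Set.range f)ᶜ : Set B) → V,
      ((Equiv.sumArrowEquivProdArrow _ _ _).symm.trans (Equiv.arrowCongr e (Equiv.refl V))) (α, β) =
        Sum.elim α β ∘ e.symm := fun β => rfl
  have h2 : ∀ β : ((Set.range f)ᶜ : Set B) → V, (Sum.elim α β ∘ e.symm) ∘ f = α := by
    intro β
    ext a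
    simp [← he]
  have h3 : ∀ β : ((Set.range f)ᶜ : Set B) → V, ∏ b, w ((Sum.elim α β ∘ e.symm) b) =
      (∏ a, w (α a)) * ∏ c, w (β c) := by
    intro β
    rw [← e.prod_comp, Fintype.prod_sum_type]
    simp
  simp only [h1, h2, h3]
  rw [← Finset.sum_mul, ← Finset.mul_sum, sum_prod_weight hw, mul_one]

end marginal

open Classical in
/-- The homomorphism density of `H` in the vertex-weighted graph `(G, w)` without normalization:
the sum of the weights of the homomorphisms that map labeled vertices according to `φ`. -/
noncomputable def PLGraph.wdensity {V : Type} [Fintype V] {S : Type*} [CommSemiring S] (H : PLGraph)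
    (G : SimpleGraph V) (w : V → S) (φ : ℕ → V) : S :=
  ∑ h : H.U → V, if H.IsHom G φ h then ∏ u, w (h u) else 0

namespace PLGraph

theorem isHom_mul_iff {V : Type} (G : SimpleGraph V) (φ : ℕ → V) (H₁ H₂ : PLGraph) (h₁ : H₁.U → V) (h₂ : H₂.U → V) :
    (mul H₁ H₂).IsHom G φ (Sum.elim h₁ h₂) ↔ H₁.IsHom G φ h₁ ∧ H₂.IsHom G φ h₂ := by
  constructor
  · intro hh
    constructor
    · intro u v huv
      have := hh (glueLeft _ _ _ _ u) (glueLeft _ _ _ _ v) (Or.inl (SimpleGraph.map_adj_apply.2 huv))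
      rcases u with u | u <;> rcases v with v | v <;> exact this
    · intro u v huv
      have := hh (glueRight _ _ _ _ u) (glueRight _ _ _ _ v)
        (Or.inr (SimpleGraph.map_adj_apply.2 huv))
      rcases u with u | u <;> rcases v with v | v <;> exact this
  · rintro ⟨h1, h2⟩ u v huv
    rcases (mul_graph_adj H₁ H₂ u v).1 huv with ⟨a, b, hab, rfl, rfl⟩ | ⟨a, b, hab, rfl, rfl⟩
    · have := h1 a b hab
      rcases a with a | a <;> rcases b with b | b <;> exact this
    · have := h2 a b hab
      rcases a with a | a <;> rcases b with b | b <;> exact this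

variable {V : Type} [Fintype V] {S : Type*} [CommSemiring S] (G : SimpleGraph V) (w : V → S)
  (φ : ℕ → V)

theorem wdensity_eq_sum {A : Type*} [Fintype A] (H : PLGraph) (e : A ≃ (H.U → V))
    [DecidablePred (H.IsHom G φ)] :
    H.wdensity G w φ = ∑ a, if H.IsHom G φ (e a) then ∏ u, w (e a u) else 0 := by
  rw [wdensity]
  exact (Finset.sum_equiv e (by simp) fun a _ => by congr).symm

theorem wdensity_congr {H H' : PLGraph} (h : H.Iso H') :
    H.wdensity G w φ = H'.wdensity G w φ := by
  classical
  obtain ⟨L, U, Γ⟩ := H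
  obtain ⟨L', U', Γ'⟩ := H'
  obtain ⟨hL, e, he⟩ := h
  dsimp only at hL
  subst hL
  dsimp only at he e
  rw [wdensity, wdensity_eq_sum (H := ⟨L, U', Γ'⟩) G w φ (Equiv.arrowCongr e (Equiv.refl V))]
  refine Finset.sum_congr rfl fun h _ => ?_
  have hiff : IsHom ⟨L, U, Γ⟩ G φ h ↔ IsHom ⟨L, U', Γ'⟩ G φ (h ∘ e.symm) := by
    constructor
    · intro hh u v huv
      have := hh (Sum.map id e.symm u) (Sum.map id e.symm v) ((he _ _).2 (by
        rcases u with u | u <;> rcases v with v | v <;> simpa using huv))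
      rcases u with u | u <;> rcases v with v | v <;> simpa using this
    · intro hh u v huv
      have := hh _ _ ((he u v).1 huv)
      rcases u with u | u <;> rcases v with v | v <;> simpa using this
  have hprod : ∏ u : U, w (h u) = ∏ u : U', w ((h ∘ e.symm) u) := by
    rw [← e.prod_comp]
    simp
  exact if_congr hiff hprod rfl

theorem wdensity_mul (H₁ H₂ : PLGraph) :
    (mul H₁ H₂).wdensity G w φ = H₁.wdensity G w φ * H₂.wdensity G w φ := by
  classical
  rw [wdensity_eq_sum G w φ _ (Equiv.sumArrowEquivProdArrow H₁.U H₂.U V).symm, wdensity, wdensity,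
    Finset.sum_mul_sum, ← Fintype.sum_prod_type']
  refine Finset.sum_congr rfl fun h _ => ?_
  have h1 : (Equiv.sumArrowEquivProdArrow H₁.U H₂.U V).symm h = Sum.elim h.1 h.2 := rfl
  rw [h1, if_congr (isHom_mul_iff G φ H₁ H₂ h.1 h.2) rfl rfl, Fintype.prod_sum_type]
  simp only [Sum.elim_inl, Sum.elim_inr]
  split_ifs <;> simp_all

theorem wdensity_of_bot (hw : ∑ v, w v = 1) {H : PLGraph} (hH : H.graph = ⊥) :
    H.wdensity G w φ = 1 := by
  classical
  have hall : ∀ h : H.U → V, H.IsHom G φ h := fun h u v huv => by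
    rw [hH] at huv
    exact huv.elim
  simp only [wdensity, hall, if_true]
  exact sum_prod_weight hw _

/-- No normalization of the weights is needed here, so densities are multiplicative maps for
indeterminate weights as well. -/
theorem wdensity_empty : empty.wdensity G w φ = 1 := by
  classical
  have hall : ∀ h : empty.U → V, empty.IsHom G φ h := fun h u v huv => huv.elim
  simp only [wdensity, hall, if_true]
  have : IsEmpty empty.U := inferInstanceAs (IsEmpty Empty)
  simp

theorem map_wdensity {S' : Type*} [CommSemiring S'] (θ : S →+* S') (H : PLGraph) :
    θ (H.wdensity G w φ) = H.wdensity G (fun v => θ (w v)) φ := by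
  simp only [wdensity, map_sum, apply_ite θ, map_prod, map_zero]

theorem density_eq_wdensity (H : PLGraph) :
    H.density G φ = H.wdensity G (fun _ => (Fintype.card V : ℝ)⁻¹) φ := by
  classical
  simp only [density, wdensity, Finset.prod_const, Finset.card_univ]
  rw [← Finset.sum_filter, Finset.sum_const, Nat.card_eq_fintype_card, Fintype.card_subtype]
  simp [div_eq_mul_inv]

/-- The density of the graph with its labels removed is the average density over the positions of
the labeled vertices. -/
theorem wdensity_unlabel (hw : ∑ v, w v = 1) (φ : ℕ → V) (v₀ : V) (H : PLGraph) {n : ℕ}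
    (hn : H.labels ⊆ Finset.range n) :
    H.unlabel.wdensity G w φ = ∑ ψ : Fin n → V, (∏ a, w (ψ a)) *
      H.wdensity G w (fun a => if h : a < n then ψ ⟨a, h⟩ else v₀) := by
  classical
  let F : (H.labels → V) → S := fun α =>
    H.wdensity G w (fun a => if h : a ∈ H.labels then α ⟨a, h⟩ else v₀)
  let ι : H.labels → Fin n := fun a => ⟨a.1, Finset.mem_range.1 (hn a.2)⟩
  have hι : Function.Injective ι := fun a b h => Subtype.ext (congrArg Fin.val h)
  have hF : ∀ ψ : Fin n → V, H.wdensity G w (fun a => if h : a < n then ψ ⟨a, h⟩ else v₀) =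
      F (ψ ∘ ι) := by
    intro ψ
    refine Finset.sum_congr rfl fun h _ => if_congr ?_ rfl rfl
    have : ∀ u : H.Vert, Sum.elim (fun a : H.labels => if h : a.1 < n then ψ ⟨a, h⟩ else v₀) h u =
        Sum.elim (fun a : H.labels => if h : a.1 ∈ H.labels then (ψ ∘ ι) ⟨a, h⟩ else v₀) h u := by
      rintro (u | u)
      · simp [ι, Finset.mem_range.1 (hn u.2)]
      · rfl
    simp only [IsHom, this]
  simp only [hF]
  rw [sum_prod_weight_comp hw hι F,
    wdensity_eq_sum G w φ _ (Equiv.sumArrowEquivProdArrow H.labels H.U V).symm, Fintype.sum_prod_type]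
  refine Finset.sum_congr rfl fun α _ => ?_
  simp only [F, wdensity, Finset.mul_sum]
  refine Finset.sum_congr rfl fun β _ => ?_
  have h1 : (Equiv.sumArrowEquivProdArrow H.labels H.U V).symm (α, β) = Sum.elim α β := rfl
  rw [h1, mul_ite, mul_zero]
  refine if_congr ?_ (by rw [Fintype.prod_sum_type]; rfl) rfl
  have h2 : ∀ u : H.Vert, Sum.elim (fun a : H.labels => if h : a.1 ∈ H.labels then α ⟨a, h⟩ else v₀)
      β u = Sum.elim α β u := by
    rintro (u | u) <;> simp
  simp only [IsHom, h2]
  constructor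
  · intro h u v huv
    exact h (Sum.inr u) (Sum.inr v) (SimpleGraph.map_adj_apply.2 huv)
  · intro h u v huv
    obtain ⟨a, b, hab, rfl, rfl⟩ := (SimpleGraph.map_adj _ _ _ _).1 huv
    exact h a b hab

end PLGraph

end QuantumGraph

namespace QuantumGraph

/-! ### Weighted densities of labeled quantum graphs -/

section wLQG

variable {V : Type} [Fintype V] {S : Type*} [CommSemiring S] [Algebra ℝ S]
  (G : SimpleGraph V) (w : V → S) (φ : ℕ → V)

/-- The weighted homomorphism density as a multiplicative map. -/
noncomputable def 𝓕.wdensity : 𝓕 →* S where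
  toFun := Quotient.lift (fun H : PLGraph => H.wdensity G w φ) fun _ _ h =>
    PLGraph.wdensity_congr G w φ h
  map_one' := PLGraph.wdensity_empty G w φ
  map_mul' := by
    rintro ⟨a⟩ ⟨b⟩
    exact PLGraph.wdensity_mul G w φ a b

/-- The weighted homomorphism density, extended linearly to `ℝ[𝓕]`. -/
noncomputable def wLQG : LQG →ₐ[ℝ] S := MonoidAlgebra.lift ℝ S 𝓕 (𝓕.wdensity G w φ)

theorem wLQG_toLQG (H : PLGraph) : wLQG G w φ (toLQG H) = H.wdensity G w φ := by
  rw [wLQG, toLQG, MonoidAlgebra.lift_of]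
  rfl

/-- With the weights taken as indeterminates a density is a polynomial; specialization then gives
its values at real weights. -/
theorem map_wLQG {S' : Type*} [CommSemiring S'] [Algebra ℝ S'] (θ : S →ₐ[ℝ] S') (f : LQG) :
    θ (wLQG G w φ f) = wLQG G (fun v => θ (w v)) φ f := by
  induction f using MonoidAlgebra.induction_on with
  | of m =>
    obtain ⟨H, rfl⟩ := Quotient.exists_rep m
    change θ (wLQG G w φ (toLQG H)) = wLQG G _ φ (toLQG H)
    rw [wLQG_toLQG, wLQG_toLQG]
    exact PLGraph.map_wdensity G w φ (θ : S →+* S') H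
  | add f g hf hg => rw [map_add, map_add, map_add, hf, hg]
  | smul r f hf => rw [map_smul, map_smul, map_smul, hf]

theorem tLQG_eq_wLQG [Nonempty V] (f : LQG) :
    tLQG G φ f = wLQG G (fun _ => (Fintype.card V : ℝ)⁻¹) φ f := by
  induction f using MonoidAlgebra.induction_on with
  | of m =>
    obtain ⟨H, rfl⟩ := Quotient.exists_rep m
    change tLQG G φ (toLQG H) = wLQG G _ φ (toLQG H)
    rw [wLQG_toLQG, tLQG_toLQG, PLGraph.density_eq_wdensity]
  | add f g hf hg => rw [map_add, map_add, hf, hg]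
  | smul r f hf => rw [map_smul, map_smul, hf]

/-- Only the total weight 1 is needed, not the sign of the weights: every one-vertex graph then has
density 1. -/
theorem wLQG_eq_zero {R : Type*} [CommRing R] [Algebra ℝ R] {w : V → R} (hw : ∑ v, w v = 1)
    {f : LQG} (hf : f ∈ 𝓚) : wLQG G w φ f = 0 := by
  have h : 𝓚 ≤ RingHom.ker (wLQG G w φ) := by
    refine Ideal.span_le.2 ?_
    rintro _ ⟨F, hF, rfl⟩
    have hb : F.graph = ⊥ := by
      rcases hF with rfl | ⟨a, rfl⟩ <;> rfl
    rw [SetLike.mem_coe, RingHom.mem_ker, map_sub, wLQG_toLQG, wLQG_toLQG,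
      PLGraph.wdensity_of_bot G w φ hw hb, PLGraph.wdensity_empty, sub_self]
  exact h hf

/-- Unlabeling is averaging over the positions of the labels `0, …, n - 1`, for large `n`. -/
theorem exists_wLQG_unlabelLQG (f : LQG) : ∃ N : ℕ, ∀ n ≥ N, ∀ (V : Type) [Fintype V]
    (G : SimpleGraph V) (w : V → ℝ) (φ : ℕ → V) (v₀ : V), ∑ v, w v = 1 →
      wLQG G w φ (unlabelLQG f) = ∑ ψ : Fin n → V, (∏ a, w (ψ a)) *
        wLQG G w (fun a => if h : a < n then ψ ⟨a, h⟩ else v₀) f := by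
  induction f using MonoidAlgebra.induction_on with
  | of m =>
    obtain ⟨H, rfl⟩ := Quotient.exists_rep m
    refine ⟨H.labels.sup id + 1, fun n hn V _ G w φ v₀ hw => ?_⟩
    change wLQG G w φ (unlabelLQG (toLQG H)) = ∑ ψ : Fin n → V, (∏ a, w (ψ a)) *
      wLQG G w _ (toLQG H)
    simp only [unlabelLQG_toLQG, wLQG_toLQG]
    refine PLGraph.wdensity_unlabel G w hw φ v₀ H fun a ha => Finset.mem_range.2 ?_
    have : a ≤ H.labels.sup id := Finset.le_sup (f := id) ha
    omega
  | add f g hf hg =>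
    obtain ⟨N₁, h₁⟩ := hf
    obtain ⟨N₂, h₂⟩ := hg
    refine ⟨max N₁ N₂, fun n hn V _ G w φ v₀ hw => ?_⟩
    simp only [map_add, mul_add, Finset.sum_add_distrib]
    rw [h₁ n (le_of_max_le_left hn) V G w φ v₀ hw, h₂ n (le_of_max_le_right hn) V G w φ v₀ hw]
  | smul r f hf =>
    obtain ⟨N, h⟩ := hf
    refine ⟨N, fun n hn V _ G w φ v₀ hw => ?_⟩
    simp only [map_smul, smul_eq_mul]
    rw [h n hn V G w φ v₀ hw, Finset.mul_sum]
    exact Finset.sum_congr rfl fun ψ _ => by ring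

open Classical in
-- Graphs between A and K correspond to subsets of E(K) \ E(A), and the alternating sum over the
-- subsets of a nonempty set is 0.
theorem sum_neg_one_pow_edges {W : Type*} [Fintype W] {R : Type*} [CommRing R] (A K : SimpleGraph W) :
    ∑ Γ ∈ (Finset.univ : Finset (SimpleGraph W)).filter (fun Γ => A ≤ Γ ∧ Γ ≤ K),
      (-1 : R) ^ (Γ.edgeSet \ A.edgeSet).ncard = if A = K then 1 else 0 := by
  by_cases hAK : A ≤ K
  · have hsum : ∑ Γ ∈ (Finset.univ : Finset (SimpleGraph W)).filter (fun Γ => A ≤ Γ ∧ Γ ≤ K),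
        (-1 : R) ^ (Γ.edgeSet \ A.edgeSet).ncard =
        ∑ T ∈ (K.edgeFinset \ A.edgeFinset).powerset, (-1 : R) ^ T.card := by
      refine Finset.sum_bij' (fun Γ _ => Γ.edgeFinset \ A.edgeFinset)
        (fun T _ => A ⊔ SimpleGraph.fromEdgeSet (T : Set (Sym2 W))) ?_ ?_ ?_ ?_ ?_
      · intro Γ hΓ
        simp only [Finset.mem_filter, Finset.mem_univ, true_and] at hΓ
        exact Finset.mem_powerset.2 (Finset.sdiff_subset_sdiff
          (SimpleGraph.edgeFinset_subset_edgeFinset.2 hΓ.2) subset_rfl)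
      · intro T hT
        simp only [Finset.mem_filter, Finset.mem_univ, true_and]
        refine ⟨le_sup_left, sup_le hAK ?_⟩
        intro u v huv
        have := Finset.mem_powerset.1 hT (SimpleGraph.fromEdgeSet_adj _ |>.1 huv).1
        simp only [Finset.mem_sdiff, SimpleGraph.mem_edgeFinset, SimpleGraph.mem_edgeSet] at this
        exact this.1
      · intro Γ hΓ
        simp only [Finset.mem_filter, Finset.mem_univ, true_and] at hΓ
        ext u v
        simp only [SimpleGraph.sup_adj, SimpleGraph.fromEdgeSet_adj, Finset.coe_sdiff,
          SimpleGraph.coe_edgeFinset, Set.mem_sdiff, SimpleGraph.mem_edgeSet]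
        constructor
        · rintro (h | h)
          · exact hΓ.1 h
          · exact h.1.1
        · intro h
          by_cases hA : A.Adj u v
          · exact Or.inl hA
          · exact Or.inr ⟨⟨h, hA⟩, h.ne⟩
      · intro T hT
        ext e
        induction e with | _ u v
        have hTe : s(u, v) ∈ T → K.Adj u v ∧ ¬ A.Adj u v := fun h => by
          simpa using Finset.mem_powerset.1 hT h
        simp only [Finset.mem_sdiff, SimpleGraph.mem_edgeFinset, SimpleGraph.mem_edgeSet,
          SimpleGraph.sup_adj, SimpleGraph.fromEdgeSet_adj, Finset.mem_coe]
        constructor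
        · rintro ⟨h | h, h'⟩
          · exact absurd h h'
          · exact h.1
        · intro h
          exact ⟨Or.inr ⟨h, (hTe h).1.ne⟩, (hTe h).2⟩
      · intro Γ hΓ
        rw [← Set.ncard_coe_finset, Finset.coe_sdiff, SimpleGraph.coe_edgeFinset,
          SimpleGraph.coe_edgeFinset]
    have hz := congrArg (Int.cast : ℤ → R)
      (Finset.sum_powerset_neg_one_pow_card (x := K.edgeFinset \ A.edgeFinset))
    push_cast at hz
    rw [hsum, hz]
    refine if_congr ?_ rfl rfl
    rw [Finset.sdiff_eq_empty_iff_subset, SimpleGraph.edgeFinset_subset_edgeFinset]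
    exact ⟨fun h => le_antisymm hAK h, fun h => h ▸ le_rfl⟩
  · rw [if_neg (fun h => hAK h.le)]
    refine Finset.sum_eq_zero fun Γ hΓ => absurd ?_ hAK
    simp only [Finset.mem_filter, Finset.mem_univ, true_and] at hΓ
    exact hΓ.1.trans hΓ.2

open Classical in
/-- The density of `ind H` counts the maps that preserve adjacency and non-adjacency. -/
theorem wLQG_ind {R : Type*} [CommRing R] [Algebra ℝ R] (w : V → R) (H : PLGraph) :
    wLQG G w φ (ind H) = ∑ h : H.U → V,
      if H.graph = G.comap (Sum.elim (fun a : H.labels => φ a.1) h) then ∏ u, w (h u) else 0 := by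
  have hterm : ∀ h : H.U → V,
      (if H.graph = G.comap (Sum.elim (fun a : H.labels => φ a.1) h) then ∏ u, w (h u) else 0) =
      ∑ Γ ∈ (Finset.univ : Finset (SimpleGraph H.Vert)).filter (fun Γ => H.graph ≤ Γ),
        (-1 : R) ^ (Γ.edgeSet \ H.graph.edgeSet).ncard *
          if PLGraph.IsHom ⟨H.labels, H.U, Γ⟩ G φ h then ∏ u, w (h u) else 0 := by
    intro h
    -- A map is a homomorphism from Γ exactly when Γ lies below the pulled-back graph, so Γ runs
    -- over an interval and the alternating sum applies.
    have h1 : ∀ Γ : SimpleGraph H.Vert, PLGraph.IsHom ⟨H.labels, H.U, Γ⟩ G φ h ↔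
        Γ ≤ G.comap (Sum.elim (fun a : H.labels => φ a.1) h) := fun Γ => Iff.rfl
    simp only [h1, mul_ite, mul_zero]
    rw [← Finset.sum_filter, Finset.filter_filter, ← Finset.sum_mul]
    have h2 := sum_neg_one_pow_edges (R := R) H.graph
      (G.comap (Sum.elim (fun a : H.labels => φ a.1) h))
    refine Eq.trans ?_ (congrArg (· * ∏ u, w (h u)) (h2.symm.trans ?_))
    · simp only [ite_mul, one_mul, zero_mul]
    · congr!
  simp only [hterm]
  rw [ind, map_sum, Finset.sum_comm]
  refine Finset.sum_congr rfl fun Γ _ => ?_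
  rw [map_smul, wLQG_toLQG, ← Finset.mul_sum, PLGraph.wdensity, Algebra.smul_def, map_pow, map_neg,
    map_one]

theorem wLQG_ind_nonneg {w : V → ℝ} (hw : ∀ v, 0 ≤ w v) (H : PLGraph) : 0 ≤ wLQG G w φ (ind H) := by
  classical
  rw [wLQG_ind]
  exact Finset.sum_nonneg fun h _ => by
    split_ifs
    exacts [Finset.prod_nonneg fun u _ => hw _, le_rfl]

end wLQG

/-! ### Rigidity of stringent graphs -/

section stringent

variable {k : ℕ} {H : SimpleGraph (Fin k)}

/-- Otherwise {i, j} would be homogeneous; k ≥ 3 makes it a proper subset. -/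
theorem IsStringent.exists_not_adj_iff (hH : IsStringent H) (hk : 3 ≤ k) {i j : Fin k} (hij : i ≠ j) :
    ∃ l, l ≠ i ∧ l ≠ j ∧ ¬ (H.Adj i l ↔ H.Adj j l) := by
  by_contra! hcon
  refine hH.1 {i, j} (by rw [Set.ncard_pair hij]; omega)
    (by rw [Set.ncard_pair hij, Fintype.card_fin]; omega) ?_
  rintro u hu v hv
  ext l
  simp only [Set.mem_sdiff, SimpleGraph.mem_neighborSet, Set.mem_insert_iff,
    Set.mem_singleton_iff, not_or, and_congr_left_iff, and_imp] at hu hv ⊢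
  intro h1 h2
  have := hcon l h1 h2
  rcases hu with rfl | rfl <;> rcases hv with rfl | rfl <;> simp [this]

/-- A map of a stringent graph to itself that preserves adjacency and non-adjacency is trivial. -/
theorem IsStringent.eq_id_of_comap (hH : IsStringent H) (hk : 3 ≤ k) {f : Fin k → Fin k}
    (hf : H = H.comap f) (i : Fin k) : f i = i := by
  have hadj : ∀ u v, H.Adj u v ↔ H.Adj (f u) (f v) := fun u v => by
    conv_lhs => rw [hf]
    rfl
  -- The neighbors of u depend only on f u, so fibers are homogeneous. A fiber with two elements
  -- must then be everything, f is constant, and no vertex could tell two others apart.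
  have hfib : ∀ v, IsHomogeneousSet H {u | f u = f v} := by
    intro v u hu u' hu'
    simp only [Set.mem_ofPred_eq] at hu hu'
    ext l
    rw [Set.mem_sdiff, Set.mem_sdiff, SimpleGraph.mem_neighborSet, SimpleGraph.mem_neighborSet,
      hadj u, hadj u', hu, hu']
  by_cases hinj : Function.Injective f
  · let e : H ≃g H := ⟨Equiv.ofBijective f (Finite.injective_iff_bijective.1 hinj),
      (hadj _ _).symm⟩
    exact hH.2 e i
  · exfalso
    simp only [Function.Injective, not_forall] at hinj
    obtain ⟨a, b, hab, hne⟩ := hinj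
    have h1 : 1 < {u | f u = f b}.ncard :=
      (Set.one_lt_ncard_iff (Set.toFinite _)).2 ⟨a, b, hab, rfl, hne⟩
    have h2 : {u | f u = f b} = Set.univ := by
      have h3 := not_lt.1 fun h => hH.1 _ h1 h (hfib b)
      refine Set.eq_of_subset_of_ncard_le (Set.subset_univ _) ?_
      rwa [Set.ncard_univ, Nat.card_eq_fintype_card]
    have h3 : ∀ u, f u = f b := fun u => Set.eq_univ_iff_forall.1 h2 u
    obtain ⟨l, -, -, hl⟩ := hH.exists_not_adj_iff hk hne
    rw [hadj a, hadj b, hab] at hl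
    exact hl Iff.rfl

/-- The hypotheses are silent on the pair formed by j and its clone, so both clone graphs are
covered. An image of the clone other than j would be distinguished from j by a third vertex. -/
theorem IsStringent.eq_of_clone (hH : IsStringent H) (hk : 3 ≤ k) (j : Fin k)
    {Γ : SimpleGraph (Finset.range k ⊕ Unit)} {φ : ℕ → Fin k} {h : Unit → Fin k}
    (h1 : ∀ a b : Fin k, Γ.Adj (Sum.inl ⟨a, Finset.mem_range.2 a.2⟩)
      (Sum.inl ⟨b, Finset.mem_range.2 b.2⟩) ↔ H.Adj a b)
    (h2 : ∀ l : Fin k, l ≠ j → (Γ.Adj (Sum.inr ()) (Sum.inl ⟨l, Finset.mem_range.2 l.2⟩) ↔ H.Adj j l))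
    (hΓ : Γ = H.comap (Sum.elim (fun a : Finset.range k => φ a.1) h)) :
    (∀ i : Fin k, φ i = i) ∧ h () = j := by
  have hφ : ∀ i : Fin k, φ i = i := by
    refine hH.eq_id_of_comap hk (f := fun i => φ i) ?_
    ext a b
    rw [← h1 a b, hΓ]
    rfl
  refine ⟨hφ, by_contra fun hne => ?_⟩
  obtain ⟨l, hl1, hl2, hl⟩ := hH.exists_not_adj_iff hk hne
  refine hl ?_
  rw [← h2 l hl2, hΓ]
  simp [hφ l]

open Classical in
theorem wLQG_clone (hH : IsStringent H) (hk : 3 ≤ k) (x : Fin k → ℝ) (φ : ℕ → Fin k) (j : Fin k) :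
    wLQG H x φ (ind (cloneGraph H j) + ind (cloneGraph' H j)) =
      if ∀ i : Fin k, φ i = i then x j else 0 := by
  have hc1 : ∀ a b : Fin k, (cloneGraph H j).graph.Adj (Sum.inl ⟨a, Finset.mem_range.2 a.2⟩)
      (Sum.inl ⟨b, Finset.mem_range.2 b.2⟩) ↔ H.Adj a b := fun a b => Iff.rfl
  have hc2 : ∀ l : Fin k, (cloneGraph H j).graph.Adj (Sum.inr ())
      (Sum.inl ⟨l, Finset.mem_range.2 l.2⟩) ↔ H.Adj j l := fun l => Iff.rfl
  have hc' : ∀ u v : Finset.range k ⊕ Unit, (cloneGraph' H j).graph.Adj u v ↔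
      (cloneGraph H j).graph.Adj u v ∨ (SimpleGraph.edge (Sum.inl ⟨j, Finset.mem_range.2 j.2⟩)
        (Sum.inr ()) : SimpleGraph (Finset.range k ⊕ Unit)).Adj u v := fun u v => Iff.rfl
  -- The clone must go to j, so the extra edge would become a loop.
  have hzero : wLQG H x φ (ind (cloneGraph' H j)) = 0 := by
    rw [wLQG_ind]
    refine Finset.sum_eq_zero fun h _ => if_neg fun hΓ => ?_
    obtain ⟨hφ, hj⟩ := hH.eq_of_clone hk j (Γ := (cloneGraph' H j).graph) (φ := φ) (h := h)
      (fun a b => (hc' _ _).trans ((or_iff_left (by simp [SimpleGraph.edge_adj])).trans (hc1 a b)))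
      (fun l hl => by
        have : (l : ℕ) ≠ j := fun h => hl (Fin.ext h)
        exact (hc' _ _).trans
          ((or_iff_left (by simp [SimpleGraph.edge_adj, this])).trans (hc2 l))) hΓ
    have hadj : (cloneGraph' H j).graph.Adj (Sum.inl ⟨j, Finset.mem_range.2 j.2⟩) (Sum.inr ()) :=
      (hc' _ _).2 (Or.inr ((SimpleGraph.edge_adj _ _ _ _).2 ⟨Or.inl ⟨rfl, rfl⟩, Sum.inl_ne_inr⟩))
    rw [hΓ] at hadj
    have hadj : H.Adj (φ j) (h ()) := hadj
    rw [hφ, hj] at hadj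
    exact hadj.ne rfl
  rw [map_add, hzero, add_zero, wLQG_ind]
  have hiff : ∀ h : Unit → Fin k, ((cloneGraph H j).graph = H.comap
      (Sum.elim (fun a : (cloneGraph H j).labels => φ a.1) h)) ↔
      (∀ i : Fin k, φ i = i) ∧ h = fun _ => j := by
    intro h
    constructor
    · intro hΓ
      obtain ⟨hφ, hj⟩ := hH.eq_of_clone hk j hc1 (fun l _ => hc2 l) hΓ
      exact ⟨hφ, funext fun _ => hj⟩
    · rintro ⟨hφ, rfl⟩
      refine congrArg H.comap (congrArg₂ Sum.elim (funext fun a => ?_) rfl)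
      exact (hφ ⟨a.1, Finset.mem_range.1 a.2⟩).symm
  split_ifs with hφ
  · rw [Finset.sum_eq_single (fun _ => j)]
    · exact (if_pos ((hiff _).2 ⟨hφ, rfl⟩)).trans (Fintype.prod_unique fun _ : Unit => x j)
    · exact fun h _ hne => if_neg fun hΓ => hne ((hiff h).1 hΓ).2
    · exact fun hj => absurd (Finset.mem_univ _) hj
  · exact Finset.sum_eq_zero fun h _ => if_neg fun hΓ => hφ ((hiff h).1 hΓ).1

end stringent

end QuantumGraph

namespace QuantumGraph

open MvPolynomial

theorem mk_unlabelLQG (f : LQG) : unlabel (toA f) = toA (unlabelLQG f) := rfl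

theorem unlabelLQG_mem_span (f : LQG) :
    unlabelLQG f ∈ Submodule.span ℝ {f : LQG | ∃ H : PLGraph, H.labels = ∅ ∧ f = toLQG H} := by
  induction f using MonoidAlgebra.induction_on with
  | of m =>
    obtain ⟨H, rfl⟩ := Quotient.exists_rep m
    exact Submodule.subset_span ⟨H.unlabel, rfl, unlabelLQG_toLQG H⟩
  | add f g hf hg => rw [map_add]; exact Submodule.add_mem _ hf hg
  | smul r f hf => rw [map_smul]; exact Submodule.smul_mem _ _ hf

theorem unlabel_mem_𝓐₀ (x : 𝓐) : unlabel x ∈ 𝓐₀ := by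
  obtain ⟨f, rfl⟩ := Ideal.Quotient.mk_surjective x
  exact ⟨_, unlabelLQG_mem_span f, rfl⟩

/-! ### Forms on the orthant and identities on the simplex -/

section forms

variable {k : ℕ} {p : MvPolynomial (Fin k) ℝ}

/-- At positive points, evaluate the even lift at the square roots and cancel the positive product;
boundary points follow by continuity. -/
theorem eval_nonneg_of_isPositiveForm (hP : IsPositiveForm (evenLift p)) {x : Fin k → ℝ}
    (hx : ∀ i, 0 ≤ x i) : 0 ≤ eval x p := by
  have hpos : ∀ x : Fin k → ℝ, (∀ i, 0 < x i) → 0 ≤ eval x p := by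
    intro x hx
    have h := hP.2 fun i => √(x i)
    rw [eval_evenLift] at h
    simp only [Real.sq_sqrt (hx _).le] at h
    exact nonneg_of_mul_nonneg_right h (Finset.prod_pos fun i _ => hx i)
  have hcont : Continuous fun ε : ℝ => eval (fun i => x i + ε) p :=
    (MvPolynomial.continuous_eval p).comp (by fun_prop)
  have hlim : Filter.Tendsto (fun ε : ℝ => eval (fun i => x i + ε) p) (nhdsWithin 0 (Set.Ioi 0))
      (nhds (eval x p)) := by
    have := (hcont.tendsto 0).mono_left (nhdsWithin_le_nhds (s := Set.Ioi 0))
    simpa using this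
  refine ge_of_tendsto hlim ?_
  filter_upwards [self_mem_nhdsWithin] with ε hε
  exact hpos _ fun i => add_pos_of_nonneg_of_pos (hx i) hε

theorem eval_mul_of_isHomogeneous {d : ℕ} (hd : p.IsHomogeneous d) (x : Fin k → ℝ) (c : ℝ) :
    eval (fun i => c * x i) p = c ^ d * eval x p := by
  rw [eval_eq', eval_eq', Finset.mul_sum]
  refine Finset.sum_congr rfl fun m hm => ?_
  have hdeg : ∑ i, m i = d := by
    rw [← Finsupp.degree_eq_sum]
    exact by_contra fun h => mem_support_iff.1 hm (hd.coeff_eq_zero h)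
  simp only [mul_pow, Finset.prod_mul_distrib, Finset.prod_pow_eq_pow_sum, hdeg]
  ring

/-- A form with p(0) ≠ 0 is constant, and then its even lift is a single square. This removes the
label positions where all clone densities vanish. -/
theorem eval_zero_of_isBadPointForm (hp : IsBadPointForm p) : eval 0 p = 0 := by
  obtain ⟨⟨d, hd⟩, hpos, hsos, -⟩ := hp
  by_contra hne
  have hd0 : d = 0 := by
    by_contra hd0
    have h := eval_mul_of_isHomogeneous hd 0 0
    rw [zero_pow hd0, zero_mul] at h
    exact hne (by simpa using h)
  subst hd0
  have hpC : p = C (p.coeff 0) := totalDegree_eq_zero_iff_eq_C.1 (by simpa using hd.totalDegree_le)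
  refine hsos ⟨hpos.1, ?_⟩
  have h0 : 0 ≤ p.coeff 0 := by
    have := eval_nonneg_of_isPositiveForm hpos (x := 0) fun _ => le_rfl
    rwa [hpC, eval_C] at this
  have : evenLift p = (C √(p.coeff 0) * ∏ i, X i) * (C √(p.coeff 0) * ∏ i, X i) := by
    rw [evenLift, hpC, coeff_C, if_pos rfl, expand_C, Finset.prod_pow]
    conv_lhs => rw [← Real.mul_self_sqrt h0, C_mul]
    ring
  rw [this]
  exact IsSumSq.mul_self _

/-- Substituting `yᵢ² / (y₁² + ⋯ + y_k²)` in a polynomial gives a polynomial after multiplication by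
a large power of `y₁² + ⋯ + y_k²`. -/
theorem exists_homogenization (g : MvPolynomial (Fin k) ℝ) : ∃ D₀ : ℕ, ∀ D ≥ D₀,
    ∃ g' : MvPolynomial (Fin k) ℝ, ∀ y : Fin k → ℝ, ∑ i, y i ^ 2 ≠ 0 →
      eval y g' = (∑ i, y i ^ 2) ^ D * eval (fun i => y i ^ 2 / ∑ i, y i ^ 2) g := by
  induction g using MvPolynomial.induction_on with
  | C a => exact ⟨0, fun D _ => ⟨(∑ i, X i ^ 2) ^ D * C a, fun y _ => by simp⟩⟩
  | add g₁ g₂ h₁ h₂ =>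
    obtain ⟨D₁, h₁⟩ := h₁
    obtain ⟨D₂, h₂⟩ := h₂
    refine ⟨max D₁ D₂, fun D hD => ?_⟩
    obtain ⟨g₁', h₁⟩ := h₁ D (le_of_max_le_left hD)
    obtain ⟨g₂', h₂⟩ := h₂ D (le_of_max_le_right hD)
    exact ⟨g₁' + g₂', fun y hy => by rw [map_add, map_add, h₁ y hy, h₂ y hy, mul_add]⟩
  | mul_X g i h =>
    obtain ⟨D₀, h⟩ := h
    refine ⟨D₀ + 1, fun D hD => ?_⟩
    obtain ⟨E, rfl⟩ : ∃ E, D = E + 1 := ⟨D - 1, by omega⟩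
    obtain ⟨g', h⟩ := h E (by omega)
    refine ⟨g' * X i ^ 2, fun y hy => ?_⟩
    simp only [map_mul, map_pow, eval_X, h y hy]
    field_simp
    ring

/-- If `x₁ ⋯ x_k p(x)` is a positive combination of squares with monomial weights on the simplex, then
`(1, 0, …, 0)` is not a bad point. -/
theorem not_isBadPointForm_of_simplex [NeZero k] {n m : ℕ} (G : (Fin n → Fin k) → Fin m → MvPolynomial (Fin k) ℝ)
    (h : ∀ x : Fin k → ℝ, ∑ i, x i = 1 → (∏ i, x i) * eval x p =
      ∑ ψ : Fin n → Fin k, (∏ a, x (ψ a)) * ∑ i, eval x (G ψ i) ^ 2) : ¬ IsBadPointForm p := by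
  classical
  rintro ⟨⟨d, hd⟩, -, -, hbad⟩
  choose D₀ hD₀ using fun ψ i => exists_homogenization (G ψ i)
  -- One exponent that clears the denominators of all the polynomials at once.
  let D := Finset.univ.sup fun c : (Fin n → Fin k) × Fin m => D₀ c.1 c.2
  choose G' hG' using fun ψ i => hD₀ ψ i D (Finset.le_sup (f := fun c : (Fin n → Fin k) × Fin m =>
    D₀ c.1 c.2) (Finset.mem_univ (ψ, i)))
  let σ : MvPolynomial (Fin k) ℝ := ∑ i, X i ^ 2
  have hσ : ∀ y : Fin k → ℝ, eval y σ = ∑ i, y i ^ 2 := fun y => by simp [σ]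
  -- The substitution contributes σ⁻ᵏ and σ⁻ᵈ on the left and σ⁻ⁿ from the weights on the right; the
  -- squares absorb σ²ᴰ. The remaining power of σ is itself a sum of squares.
  have hid : (σ ^ (n + D)) ^ 2 * evenLift p = σ ^ (n + d + k) *
      ∑ ψ : Fin n → Fin k, ∑ i, ((∏ a, X (ψ a)) * G' ψ i) ^ 2 := by
    refine MvPolynomial.funext fun y => ?_
    simp only [map_mul, map_pow, map_sum, map_prod, eval_X, hσ, eval_evenLift]
    by_cases hr : ∑ i, y i ^ 2 = 0
    -- Here y = 0, and both sides vanish because k > 0.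
    · have hy : ∏ i, y i ^ 2 = 0 := Finset.prod_eq_zero (Finset.mem_univ 0)
        ((Finset.sum_eq_zero_iff_of_nonneg fun i _ => sq_nonneg _).1 hr 0 (Finset.mem_univ _))
      rw [hr, hy, zero_pow (n := n + d + k) (by have := NeZero.ne k; omega)]
      ring
    · have hx := h (fun i => y i ^ 2 / ∑ i, y i ^ 2) (by rw [← Finset.sum_div, div_self hr])
      have hdiv := eval_mul_of_isHomogeneous hd (fun i => y i ^ 2) (∑ i, y i ^ 2)⁻¹
      simp only [inv_mul_eq_div, inv_pow] at hdiv
      rw [hdiv] at hx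
      simp only [mul_pow, hG' _ _ y hr]
      generalize (∑ i, y i ^ 2) = r at *
      simp only [Finset.prod_div_distrib, Finset.prod_const, Finset.card_univ, Fintype.card_fin] at hx
      have hterm : ∀ ψ : Fin n → Fin k, ∑ i, (∏ a, y (ψ a)) ^ 2 *
          ((r ^ D) ^ 2 * eval (fun i => y i ^ 2 / r) (G ψ i) ^ 2) = r ^ n * (r ^ D) ^ 2 *
          ((∏ a, y (ψ a) ^ 2) / r ^ n * ∑ i, eval (fun i => y i ^ 2 / r) (G ψ i) ^ 2) := by
        intro ψ
        rw [Finset.mul_sum, Finset.mul_sum, Finset.prod_pow]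
        refine Finset.sum_congr rfl fun i _ => ?_
        field_simp
      simp only [hterm]
      rw [← Finset.mul_sum, ← hx]
      field_simp
      ring
  have hform : IsForm ((σ ^ (n + D)) ^ 2 * evenLift p) := by
    have hσh : σ.IsHomogeneous 2 := IsHomogeneous.sum _ _ _ fun i _ => isHomogeneous_X_pow i 2
    exact ⟨_, ((hσh.pow _).pow _).mul (isHomogeneous_evenLift hd)⟩
  have hsos : IsSumSq ((σ ^ (n + D)) ^ 2 * evenLift p) := by
    rw [hid, ← Finset.card_range (n + d + k), ← Finset.prod_const]
    exact (IsSumSq.prod fun i _ => IsSumSq.sum_sq _ _).mul (IsSumSq.sum fun ψ _ => IsSumSq.sum_sq _ _)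
  have hone := hbad _ ⟨hform, hsos⟩
  have hsum : ∑ i : Fin k, (if i.1 = 0 then (1 : ℝ) else 0) ^ 2 = 1 := by
    rw [Finset.sum_eq_single 0 (fun i _ hi => by
      rw [if_neg (fun h => hi (Fin.val_eq_zero_iff.1 h)), zero_pow two_ne_zero]) (by simp)]
    simp
  rw [map_pow, hσ, hsum, one_pow] at hone
  exact one_ne_zero hone

end forms

/-! ### Positivity of ⟦φ_H(p)⟧ and the obstruction to sums of squares -/

theorem phi_eq_toA {k : ℕ} (H : SimpleGraph (Fin k)) (p : MvPolynomial (Fin k) ℝ) :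
    phi H p = toA (aeval (fun j => ind (cloneGraph H j) + ind (cloneGraph' H j)) p) := by
  rw [phi, ← AlgHom.comp_apply, comp_aeval]

theorem map_aeval_eq_eval {A : Type*} [CommRing A] [Algebra ℝ A] {k : ℕ} (θ : A →ₐ[ℝ] ℝ) (y : Fin k → A)
    (p : MvPolynomial (Fin k) ℝ) : θ (aeval y p) = eval (fun j => θ (y j)) p := by
  rw [← AlgHom.comp_apply, comp_aeval, aeval_eq_eval]

theorem isPositive_unlabel_phi {k : ℕ} (H : SimpleGraph (Fin k)) {p : MvPolynomial (Fin k) ℝ}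
    (hp : IsPositiveForm (evenLift p)) : IsPositive (unlabel (phi H p)) := by
  intro V _ _ G φ
  obtain ⟨v₀⟩ := ‹Nonempty V›
  have : Nonempty V := ⟨v₀⟩
  rw [phi_eq_toA, mk_unlabelLQG]
  change 0 ≤ tLQG G φ (unlabelLQG _)
  rw [tLQG_eq_wLQG]
  have hw : ∑ _v : V, (Fintype.card V : ℝ)⁻¹ = 1 := by simp
  have hw0 : (0 : ℝ) ≤ (Fintype.card V : ℝ)⁻¹ := by positivity
  obtain ⟨N, hN⟩ := exists_wLQG_unlabelLQG
    (aeval (fun j => ind (cloneGraph H j) + ind (cloneGraph' H j)) p)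
  rw [hN N le_rfl V G _ φ v₀ hw]
  refine Finset.sum_nonneg fun ψ _ => mul_nonneg (Finset.prod_nonneg fun _ _ => hw0) ?_
  rw [map_aeval_eq_eval]
  refine eval_nonneg_of_isPositiveForm hp fun j => ?_
  rw [map_add]
  exact add_nonneg (wLQG_ind_nonneg G _ (fun _ => hw0) _) (wLQG_ind_nonneg G _ (fun _ => hw0) _)

theorem not_isExpressibleAsSOS_unlabel_phi {k : ℕ} (hk : 4 ≤ k) {H : SimpleGraph (Fin k)}
    (hH : IsStringent H) {p : MvPolynomial (Fin k) ℝ} (hp : IsBadPointForm p) :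
    ¬ IsExpressibleAsSOS (unlabel (phi H p)) := by
  classical
  rintro ⟨m, g, hg⟩
  have : NeZero k := ⟨by omega⟩
  choose f hf using fun i => Ideal.Quotient.mk_surjective (g i)
  have hf : ∀ i, toA (f i) = g i := hf
  let P : LQG := aeval (fun j => ind (cloneGraph H j) + ind (cloneGraph' H j)) p
  obtain ⟨N₁, hN₁⟩ := exists_wLQG_unlabelLQG P
  obtain ⟨N₂, hN₂⟩ := exists_wLQG_unlabelLQG (∑ i, f i ^ 2)
  -- Both averaging formulas hold for this n, and the labels 0, …, k-1 of H are among those averaged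
  -- over.
  let n := max k (max N₁ N₂)
  have hkn : k ≤ n := le_max_left _ _
  let ext : (Fin n → Fin k) → ℕ → Fin k := fun ψ a => if h : a < n then ψ ⟨a, h⟩ else 0
  have hmem : unlabelLQG P - unlabelLQG (∑ i, f i ^ 2) ∈ 𝓚 := by
    refine Ideal.Quotient.eq.1 ?_
    change toA (unlabelLQG P) = toA (unlabelLQG (∑ i, f i ^ 2))
    rw [← mk_unlabelLQG, ← mk_unlabelLQG, ← phi_eq_toA, hg]
    simp only [map_sum, map_pow, hf]
  -- The polynomials are the densities of the `f i` in H with indeterminate weights, one for each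
  -- placement of the labels.
  refine not_isBadPointForm_of_simplex (n := n) (m := m) (fun ψ i => wLQG H X (ext ψ) (f i)) ?_ hp
  intro x hx
  have heq := wLQG_eq_zero H (fun _ => 0) hx hmem
  rw [map_sub, sub_eq_zero,
    hN₁ n ((le_max_left _ _).trans (le_max_right _ _)) _ H x _ 0 hx,
    hN₂ n ((le_max_right _ _).trans (le_max_right _ _)) _ H x _ 0 hx] at heq
  have hR : ∀ ψ i, eval x (wLQG H X (ext ψ) (f i)) = wLQG H x (ext ψ) (f i) := by
    intro ψ i
    have := map_wLQG H X (ext ψ) (aeval x : MvPolynomial (Fin k) ℝ →ₐ[ℝ] ℝ) (f i)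
    simpa [aeval_eq_eval] using this
  simp only [hR]
  simp only [map_sum, map_pow] at heq
  refine Eq.trans ?_ heq
  have hL : ∀ ψ : Fin n → Fin k, wLQG H x (ext ψ) P =
      if ψ ∘ Fin.castLE hkn = id then eval x p else 0 := by
    intro ψ
    have hiff : (∀ i : Fin k, ext ψ i = i) ↔ ψ ∘ Fin.castLE hkn = id := by
      rw [_root_.funext_iff]
      refine forall_congr' fun i => ?_
      simp only [ext, dif_pos (i.2.trans_le hkn)]
      rfl
    rw [map_aeval_eq_eval]
    simp only [wLQG_clone hH (by omega : 3 ≤ k), hiff]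
    split_ifs with hψ
    · rfl
    · exact eval_zero_of_isBadPointForm hp
  change _ = ∑ ψ : Fin n → Fin k, (∏ a, x (ψ a)) * wLQG H x (ext ψ) P
  simp only [hL]
  -- Labels from k on integrate out; among the placements of the first k only the identity survives,
  -- with weight x₁⋯x_k.
  rw [sum_prod_weight_comp hx (Fin.castLE_injective hkn) fun ψ => if ψ = id then eval x p else 0]
  simp

end QuantumGraph

open QuantumGraph in
/-- There is a positive quantum graph that is not expressible as a sum of squares, and it can be
taken of the form `⟦φ_H(p)⟧` with `H` stringent and `p` derived from a form with a bad point at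
`(1, 0, …, 0)`; moreover every such `⟦φ_H(p)⟧` is an example. -/
theorem mainTheorem2 :
    (∃ x : 𝓐,
      (∃ (k : ℕ) (H : SimpleGraph (Fin k)) (p : MvPolynomial (Fin k) ℝ),
        4 ≤ k ∧ IsStringent H ∧ IsBadPointForm p ∧ x = QuantumGraph.unlabel (phi H p)) ∧
      x ∈ 𝓐₀ ∧ IsPositive x ∧ ¬ IsExpressibleAsSOS x) ∧
    (∀ (k : ℕ) (H : SimpleGraph (Fin k)) (p : MvPolynomial (Fin k) ℝ),
      4 ≤ k → IsStringent H → IsBadPointForm p →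
        QuantumGraph.unlabel (phi H p) ∈ 𝓐₀ ∧ IsPositive (QuantumGraph.unlabel (phi H p)) ∧
          ¬ IsExpressibleAsSOS (QuantumGraph.unlabel (phi H p))) := by
  have hall : ∀ (k : ℕ) (H : SimpleGraph (Fin k)) (p : MvPolynomial (Fin k) ℝ),
      4 ≤ k → IsStringent H → IsBadPointForm p →
        QuantumGraph.unlabel (phi H p) ∈ 𝓐₀ ∧ IsPositive (QuantumGraph.unlabel (phi H p)) ∧
          ¬ IsExpressibleAsSOS (QuantumGraph.unlabel (phi H p)) := fun k H p hk hH hp =>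
    ⟨unlabel_mem_𝓐₀ _, isPositive_unlabel_phi H hp.2.1, not_isExpressibleAsSOS_unlabel_phi hk hH hp⟩
  exact ⟨⟨_, ⟨6, asymmetricGraph, motzkinForm, by norm_num, isStringent_asymmetricGraph,
    isBadPointForm_motzkinForm, rfl⟩, hall _ _ _ (by norm_num) isStringent_asymmetricGraph
    isBadPointForm_motzkinForm⟩, hall⟩
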